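/- Let $1<\alpha\le 2$, and let $W$ be a space-time white noise on $(0,\infty)\times\mathbf{R}$, defined on a probability space $(\Omega,\mathcal{F},\mathrm{P})$; that is, a centered Gaussian process indexed by $L^2((0,\infty)\times\mathbf{R})$ with $\mathrm{Cov}(W(f),W(g))=\langle f,g\rangle_{L^2}$, where $W(f)$ is also written $\int f\,\mathrm{d}W$. Let $$c_\alpha:=\left(\frac{\Gamma(1/\alpha)}{\pi(\alpha-1)}\right)^{1/2},$$ and let $p_t(x)=\frac1{2\pi}\int_{-\infty}^\infty \mathrm{e}^{-i\xi x}\mathrm{e}^{-t|\xi|^\alpha/2}\,\mathrm{d}\xi$ $(t>0)$ denote the fundamental solution of $\partial_t-\frac12\Delta_{\alpha/2}$, where $\Delta_{\alpha/2}=-(-\Delta)^{\alpha/2}$. Let $v$ be the mild solution of the linear fractional stochastic heat equation $\partial_t v_t(x)=\frac12(\Delta_{\alpha/2}v_t)(x)+\dot W_t(x)$ with $v_0\equiv0$; that is, for all $t\ge0$ and $x\in\mathbf{R}$, $$v_t(x)=\int_{(0,t)\times\mathbf{R}}p_{t-s}(y-x)\,W(\mathrm{d}s\,\mathrm{d}y)\qquad\text{a.s.}$$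 Then there is a version of $v$ such that $t\mapsto v_t(x)$ is continuous for every $x\in\mathbf{R}$. Moreover, for every version $v$ and every fixed $x\in\mathbf{R}$ such that $t\mapsto v_t(x)$ is a.s. continuous, the following hold. 1. The process $t\mapsto c_\alpha^{-1}v_t(x)$ is a bifractional Brownian motion with parameters $H=\frac12$ and $K=\frac{\alpha-1}{\alpha}$. Here a bifractional Brownian motion with parameters $H\in(0,1)$ and $K\in(0,1]$ is a continuous, mean-zero Gaussian process $B$ with $B_0=0$ a.s. and $\mathrm{Cov}(B_s,B_t)=2^{-K}\left([s^{2H}+t^{2H}]^K-|t-s|^{2HK}\right)$ for all $s,t\ge0$. 2. There exist processes $X=\{X_t\}_{t\ge0}$ and $R=\{R_t\}_{t\ge0}$ on $(\Omega,\mathcal{F},\mathrm{P})$ such that, outside a single $\mathrm{P}$-null set, $$v_t(x)=c_\alpha\,2^{1/(2\alpha)}X_t+R_t\qquad\text{for all }t\ge0,$$ where $X$ is a fractional Brownian motion with Hurst parameter $H=\frac{\alpha-1}{2\alpha}$ (a continuous, mean-zero Gaussian process with $X_0=0$ a.s. and $\mathrm{E}(|X_t-X_s|^2)=|t-s|^{2H}$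 for all $s,t\ge0$), and $R$ is a centered Gaussian process that is (i) independent of the process $\{v_t(x)\}_{t\ge0}$; (ii) a.s. absolutely continuous on $[0,\infty)$, i.e. on $[0,T]$ for every $T\ge 0$; and (iii) a.s. infinitely differentiable on $(0,\infty)$. -/

import Mathlib

open MeasureTheory ProbabilityTheory Set
open scoped NNReal

noncomputable section

/-- `X` is a (standard) fractional Brownian motion `fBm(H)`, `0 < H < 1`: a continuous, mean-zero
Gaussian process with `X 0 = 0` a.s. and `E |X t - X s| ^ 2 = |t - s| ^ (2 H)`. -/
structure IsFractionalBM {Ω : Type*} [MeasurableSpace Ω] (H : ℝ) (X : ℝ≥0 → Ω → ℝ)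
    (P : Measure Ω) : Prop where
  hurst : 0 < H ∧ H < 1
  gaussian : IsGaussianProcess X P
  mean_zero : ∀ t, ∫ ω, X t ω ∂P = 0
  start : ∀ᵐ ω ∂P, X 0 ω = 0
  increments : ∀ s t : ℝ≥0, ∫ ω, |X t ω - X s ω| ^ 2 ∂P = |(t : ℝ) - (s : ℝ)| ^ (2 * H)
  continuous_paths : ∀ᵐ ω ∂P, Continuous fun t => X t ω

/-- `B` is a (standard) bifractional Brownian motion `bi-fBm(H, K)`, `0 < H < 1`, `0 < K ≤ 1`:
a continuous, mean-zero Gaussian process with `B 0 = 0` a.s. and covariance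
`2 ^ (-K) * ((s ^ (2 H) + t ^ (2 H)) ^ K - |s - t| ^ (2 H K))`. -/
structure IsBifractionalBM {Ω : Type*} [MeasurableSpace Ω] (H K : ℝ) (B : ℝ≥0 → Ω → ℝ)
    (P : Measure Ω) : Prop where
  param_fst : 0 < H ∧ H < 1
  param_snd : 0 < K ∧ K ≤ 1
  gaussian : IsGaussianProcess B P
  mean_zero : ∀ t, ∫ ω, B t ω ∂P = 0
  start : ∀ᵐ ω ∂P, B 0 ω = 0
  covariance : ∀ s t : ℝ≥0, cov[B s, B t; P] =
    (2 : ℝ) ^ (-K) * (((s : ℝ) ^ (2 * H) + (t : ℝ) ^ (2 * H)) ^ K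
      - |(s : ℝ) - (t : ℝ)| ^ (2 * H * K))
  continuous_paths : ∀ᵐ ω ∂P, Continuous fun t => B t ω

/-- Lebesgue measure on the space-time domain `(0, ∞) × ℝ`, as a measure on `ℝ × ℝ`
(first coordinate: time; second coordinate: space). -/
def spaceTimeMeasure : Measure (ℝ × ℝ) :=
  (volume.restrict (Ioi (0 : ℝ))).prod volume

/-- `W` is a space-time white noise on `(0, ∞) × ℝ`: the centered Gaussian process indexed by
`L²((0, ∞) × ℝ)` with `Cov (W f, W g) = ⟨f, g⟩` (the isonormal process). The noise of a Borel set
`A` of finite measure is `W 1_A`, the Brownian sheet is `(t, x) ↦ W 1_{[0,t] × [0,x]}`, and `W f`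
is the Wiener integral of `f`. -/
structure IsSpaceTimeWhiteNoise {Ω : Type*} [MeasurableSpace Ω]
    (W : Lp ℝ 2 spaceTimeMeasure → Ω → ℝ) (P : Measure Ω) : Prop where
  gaussian : IsGaussianProcess W P
  mean_zero : ∀ f, ∫ ω, W f ω ∂P = 0
  covariance : ∀ f g, cov[W f, W g; P] = inner ℝ f g

open Classical in
/-- The Wiener integral `∫ f(s, y) W(ds dy)` of a deterministic function `f` on `(0, ∞) × ℝ`
(with the value `0` if `f` is not square integrable). -/
def wienerIntegral {Ω : Type*} (W : Lp ℝ 2 spaceTimeMeasure → Ω → ℝ) (f : ℝ × ℝ → ℝ) : Ω → ℝ :=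
  if hf : MemLp f 2 spaceTimeMeasure then W (hf.toLp f) else fun _ => 0

/-- The fundamental solution `p_t(x)`, `t > 0`, of `∂/∂t - (1/2) Δ_{α/2}`, i.e. the transition
density of the symmetric `α`-stable Lévy process with `∫ e^{iξx} p_t(x) dx = exp(-t |ξ|^α / 2)`,
given by Fourier inversion: `p_t(x) = (2π)⁻¹ ∫ e^{-iξx} exp(-t |ξ|^α / 2) dξ`, where only the
cosine survives because `exp(-t |ξ|^α / 2)` is even in `ξ`. -/
def stableKernel (α t x : ℝ) : ℝ :=
  (2 * Real.pi)⁻¹ * ∫ ξ : ℝ, Real.cos (ξ * x) * Real.exp (-(t * |ξ| ^ α / 2))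

open Classical in
/-- The integrand `(s, y) ↦ 1_{(0,t)}(s) p_{t-s}(y-x)`. -/
def mildIntegrand (α t x : ℝ) (q : ℝ × ℝ) : ℝ :=
  if 0 < q.1 ∧ q.1 < t then stableKernel α (t - q.1) (q.2 - x) else 0

/-- `v` is a version of the mild solution of the linear fractional stochastic heat equation
`∂v/∂t = (1/2) Δ_{α/2} v + Ẇ`, `v_0 = 0`: for all `t ≥ 0` and `x`, almost surely
`v_t(x) = ∫_{(0,t) × ℝ} p_{t-s}(y-x) W(ds dy)`. -/
def IsMildSolution {Ω : Type*} [MeasurableSpace Ω] (α : ℝ)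
    (W : Lp ℝ 2 spaceTimeMeasure → Ω → ℝ) (v : ℝ≥0 → ℝ → Ω → ℝ) (P : Measure Ω) : Prop :=
  ∀ (t : ℝ≥0) (x : ℝ), v t x =ᵐ[P] wienerIntegral W (mildIntegrand α t x)

/-- The constant `c_α = (Γ(1/α) / (π (α - 1)))^{1/2}`. -/
def cAlpha (α : ℝ) : ℝ :=
  √(Real.Gamma (1 / α) / (Real.pi * (α - 1)))

end

/-! Put K = (α-1)/α. By Plancherel, the L² pairing of p_a and p_b is a multiple of (a+b)^(-1/α).
Integrating this over time up to min(s,t) gives the covariance of v(x), namely c_α² 2^(-K) ((s+t)^K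
- |s-t|^K) (`inner_mildElement`). This is the bifractional covariance with H = 1/2. Concavity of u ↦
u^K bounds the variance of an increment by a multiple of |t-s|^K, so Gaussian moments and
Kolmogorov's criterion yield a continuous version.

For the decomposition, write (s+t)^K - |s-t|^K as [s^K + t^K - |s-t|^K] - [s^K + t^K - (s+t)^K]. If
R is independent of v(x) and has the second bracket, times c_α² 2^(-K), as covariance, then v(x) - R
has the covariance of a multiple of fractional Brownian motion.

Two points remain. R must live on the given probability space: since p_t is even, every function odd
in space about x is orthogonal to the integrands of v(x), so the noise W on an orthonormal sequence
of odd functions (`orthonormal_oddElement`) is independent of v(x) and supplies the randomness. R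
must also be smooth (`IsIsonormal.exists_smooth_process`): the mixed derivative of its covariance is
a multiple of (s+t)^(-p) with p = 2-K. In the variable u = (s-1)/(s+1) this kernel has a binomial
expansion ∑ b_k(s) b_k(t), so R is the primitive of ∑ b_k ζ_k with ζ_k independent standard normals.
That series is a random power series in u converging for |u| < 1, hence smooth on (0,∞), and it is
integrable at 0 because p < 2. -/

/-! ### Isonormal processes: almost sure linearity and moments. -/

section Isonormal

/-- The isonormal Gaussian process indexed by a real inner product space. -/
structure IsIsonormal {Ω H : Type*} [MeasurableSpace Ω] [NormedAddCommGroup H]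
    [InnerProductSpace ℝ H] (W : H → Ω → ℝ) (P : Measure Ω) : Prop where
  gaussian : IsGaussianProcess W P
  mean_zero : ∀ f, ∫ ω, W f ω ∂P = 0
  covariance : ∀ f g, cov[W f, W g; P] = inner ℝ f g

lemma ae_eq_zero_of_covariance_self_eq_zero {Ω : Type*} [MeasurableSpace Ω] {P : Measure Ω}
    [IsProbabilityMeasure P] {Z : Ω → ℝ} (hZ : MemLp Z 2 P) (h0 : ∫ ω, Z ω ∂P = 0)
    (hc : cov[Z, Z; P] = 0) : Z =ᵐ[P] 0 := by
  have h1 : ∫ ω, Z ω * Z ω ∂P = 0 := by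
    rw [covariance_eq_sub hZ hZ, h0] at hc
    simpa using hc
  rw [integral_eq_zero_iff_of_nonneg (fun ω => mul_self_nonneg _) (hZ.integrable_mul hZ)] at h1
  filter_upwards [h1] with ω hω
  simpa using hω

namespace IsIsonormal

variable {Ω H : Type*} [MeasurableSpace Ω] [NormedAddCommGroup H] [InnerProductSpace ℝ H]
  {W : H → Ω → ℝ} {P : Measure Ω}

lemma memLp (hW : IsIsonormal W P) (f : H) {p : ENNReal} (hp : p ≠ ⊤) : MemLp (W f) p P :=
  (hW.gaussian.hasGaussianLaw_eval f).memLp hp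

lemma memLp_two (hW : IsIsonormal W P) (f : H) : MemLp (W f) 2 P :=
  hW.memLp f (by norm_num)

lemma integrable (hW : IsIsonormal W P) (f : H) : Integrable (W f) P :=
  (hW.gaussian.hasGaussianLaw_eval f).integrable

lemma aemeasurable (hW : IsIsonormal W P) (f : H) : AEMeasurable (W f) P :=
  hW.gaussian.aemeasurable f

lemma integral_mul (hW : IsIsonormal W P) (f g : H) :
    ∫ ω, W f ω * W g ω ∂P = inner ℝ f g := by
  have := hW.gaussian.isProbabilityMeasure
  rw [← hW.covariance, covariance_eq_sub (hW.memLp_two f) (hW.memLp_two g), hW.mean_zero]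
  simp

/-- Linearity is not an axiom of an isonormal process. It follows because the difference is centered
and, by bilinearity of the covariance, has variance zero. -/
lemma add (hW : IsIsonormal W P) (f g : H) : W (f + g) =ᵐ[P] W f + W g := by
  have := hW.gaussian.isProbabilityMeasure
  have hA := hW.memLp_two f
  have hB := hW.memLp_two g
  have hX := hW.memLp_two (f + g)
  have h : W (f + g) - (W f + W g) =ᵐ[P] 0 := by
    refine ae_eq_zero_of_covariance_self_eq_zero (hX.sub (hA.add hB)) ?_ ?_
    · rw [integral_sub' (hW.integrable _) ((hW.integrable _).add (hW.integrable _)),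
        integral_add' (hW.integrable _) (hW.integrable _)]
      simp [hW.mean_zero]
    · rw [covariance_sub_left hX (hA.add hB) (hX.sub (hA.add hB)),
        covariance_sub_right hX hX (hA.add hB),
        covariance_sub_right (hA.add hB) hX (hA.add hB),
        covariance_add_left hA hB hX, covariance_add_right hX hA hB,
        covariance_add_left hA hB (hA.add hB), covariance_add_right hA hA hB,
        covariance_add_right hB hA hB]
      simp only [hW.covariance, inner_add_left, inner_add_right]
      ring
  filter_upwards [h] with ω hω
  simpa [sub_eq_zero] using hω

lemma smul (hW : IsIsonormal W P) (c : ℝ) (f : H) : W (c • f) =ᵐ[P] c • W f := by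
  have := hW.gaussian.isProbabilityMeasure
  have hA := (hW.memLp_two f).const_smul c
  have hX := hW.memLp_two (c • f)
  have h : W (c • f) - c • W f =ᵐ[P] 0 := by
    refine ae_eq_zero_of_covariance_self_eq_zero (hX.sub hA) ?_ ?_
    · have : ∀ ω, (W (c • f) - c • W f) ω = W (c • f) ω - c * W f ω := fun _ => rfl
      simp_rw [this]
      rw [integral_sub (hW.integrable _) ((hW.integrable _).const_mul _), integral_const_mul]
      simp [hW.mean_zero]
    · rw [covariance_sub_left hX hA (hX.sub hA), covariance_sub_right hX hX hA,
        covariance_sub_right hA hX hA]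
      simp only [covariance_smul_left, covariance_smul_right, hW.covariance, inner_smul_left,
        inner_smul_right]
      simp
  filter_upwards [h] with ω hω
  simpa [sub_eq_zero] using hω

lemma sub (hW : IsIsonormal W P) (f g : H) : W (f - g) =ᵐ[P] W f - W g := by
  have h1 := hW.add f ((-1 : ℝ) • g)
  have h2 := hW.smul (-1) g
  have : f - g = f + (-1 : ℝ) • g := by simp [sub_eq_add_neg]
  rw [this]
  filter_upwards [h1, h2] with ω h1 h2
  rw [h1, Pi.add_apply, h2]
  simp [sub_eq_add_neg]

lemma zero (hW : IsIsonormal W P) : W 0 =ᵐ[P] 0 := by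
  have h := hW.smul 0 0
  simpa using h

lemma sum (hW : IsIsonormal W P) {ι : Type*} (s : Finset ι) (c : ι → ℝ) (e : ι → H) :
    W (∑ i ∈ s, c i • e i) =ᵐ[P] fun ω => ∑ i ∈ s, c i * W (e i) ω := by
  classical
  induction s using Finset.induction_on with
  | empty => simpa using! hW.zero
  | insert i s hi ih =>
    rw [Finset.sum_insert hi]
    filter_upwards [ih, hW.add (c i • e i) (∑ i ∈ s, c i • e i), hW.smul (c i) (e i)]
      with ω h1 h2 h3
    simp [Finset.sum_insert hi, h1, h2, h3]

lemma map_eq (hW : IsIsonormal W P) (f : H) :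
    P.map (W f) = (gaussianReal 0 1).map (‖f‖ * ·) := by
  rw [(hW.gaussian.hasGaussianLaw_eval f).map_eq_gaussianReal, gaussianReal_map_const_mul,
    hW.mean_zero, ← covariance_self (hW.aemeasurable f), hW.covariance,
    real_inner_self_eq_norm_sq]
  congr 1
  · simp
  · ext; simp

/-- `W f` has the law of ‖f‖ times a standard normal variable, so its moments are powers of ‖f‖ up
to a universal factor. -/
lemma lintegral_enorm_rpow (hW : IsIsonormal W P) (f : H) {q : ℝ} (hq : 0 ≤ q) :
    ∫⁻ ω, ‖W f ω‖ₑ ^ q ∂P = ENNReal.ofReal (‖f‖ ^ q) * ∫⁻ z, ‖z‖ₑ ^ q ∂(gaussianReal 0 1) := by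
  have h1 : ∫⁻ ω, ‖W f ω‖ₑ ^ q ∂P = ∫⁻ z, ‖z‖ₑ ^ q ∂(P.map (W f)) := by
    rw [lintegral_map' (by fun_prop) (hW.aemeasurable f)]
  rw [h1, hW.map_eq, lintegral_map (by fun_prop) (by fun_prop),
    ← lintegral_const_mul _ (by fun_prop)]
  refine lintegral_congr fun z => ?_
  rw [enorm_mul, ENNReal.mul_rpow_of_nonneg _ _ hq, enorm_norm, ← ofReal_norm,
    ENNReal.ofReal_rpow_of_nonneg (norm_nonneg _) hq]

lemma lintegral_enorm_rpow_gaussian_lt_top {q : ℝ} (hq : 0 < q) :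
    ∫⁻ z, ‖z‖ₑ ^ q ∂(gaussianReal 0 1) < ⊤ := by
  have h := (memLp_id_gaussianReal (μ := 0) (v := 1) q.toNNReal).2
  have := lintegral_rpow_enorm_lt_top_of_eLpNorm_lt_top (p := (q.toNNReal : ENNReal))
    (by simpa using hq) (by simp) h
  simpa [hq.le] using this

/-- The L¹ norm is at most the L² norm, which equals ‖f‖. This turns convergence in `H` into L¹
convergence of random variables. -/
lemma lintegral_enorm_le (hW : IsIsonormal W P) (f : H) :
    ∫⁻ ω, ‖W f ω‖ₑ ∂P ≤ ‖f‖ₑ := by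
  have := hW.gaussian.isProbabilityMeasure
  have h1 : eLpNorm (W f) 1 P ≤ eLpNorm (W f) 2 P :=
    eLpNorm_le_eLpNorm_of_exponent_le (by norm_num) (hW.aemeasurable f).aestronglyMeasurable
  rw [eLpNorm_one_eq_lintegral_enorm] at h1
  refine h1.trans (le_of_eq ?_)
  rw [(hW.memLp_two f).eLpNorm_eq_integral_rpow_norm (by norm_num) (by norm_num), ← ofReal_norm]
  congr 1
  have : ∀ ω, ‖W f ω‖ ^ (2 : ENNReal).toReal = W f ω * W f ω := fun ω => by
    simp [sq]
  simp_rw [this, hW.integral_mul, real_inner_self_eq_norm_sq]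
  rw [← Real.rpow_natCast, ← Real.rpow_mul (norm_nonneg _)]
  simp

end IsIsonormal

end Isonormal

/-! ### Kolmogorov's continuity criterion by dyadic approximation. -/

section Kolmogorov

open Filter Topology

/-- The largest dyadic number of level `n` below `t`. -/
noncomputable def dyadicFloor (n : ℕ) (t : ℝ≥0) : ℝ≥0 := (⌊2 ^ n * t⌋₊ : ℝ≥0) / 2 ^ n

lemma dyadicFloor_le (n : ℕ) (t : ℝ≥0) : dyadicFloor n t ≤ t := by
  rw [dyadicFloor, div_le_iff₀ (by positivity), mul_comm]
  exact Nat.floor_le (by positivity)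

lemma lt_dyadicFloor_add (n : ℕ) (t : ℝ≥0) : t < dyadicFloor n t + 1 / 2 ^ n := by
  rw [dyadicFloor, ← add_div, lt_div_iff₀ (by positivity), mul_comm]
  exact Nat.lt_floor_add_one _

section Deterministic

variable {y : ℝ≥0 → ℝ} {M : ℕ → ℝ}

/-- Refining the level either keeps the dyadic floor or moves it by one step of the finer grid. The
range `k < n * 2 ^ n` covers [0, n], so a single sequence `M` eventually controls every compact
interval. -/
lemma abs_dyadicFloor_succ_sub_le (hM0 : ∀ n, 0 ≤ M n)
    (h : ∀ n k : ℕ, k < n * 2 ^ n → |y ((k + 1 : ℕ) / 2 ^ n) - y ((k : ℕ) / 2 ^ n)| ≤ M n)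
    {n : ℕ} {t : ℝ≥0} (ht : t ≤ n) :
    |y (dyadicFloor (n + 1) t) - y (dyadicFloor n t)| ≤ M (n + 1) := by
  set m := ⌊2 ^ n * t⌋₊ with hm
  have h1 : (m : ℝ≥0) ≤ 2 ^ n * t := Nat.floor_le (by positivity)
  have h2 : 2 ^ n * t < m + 1 := Nat.lt_floor_add_one _
  have h3 : ⌊2 ^ (n + 1) * t⌋₊ = 2 * m ∨ ⌊2 ^ (n + 1) * t⌋₊ = 2 * m + 1 := by
    have h4 : 2 * m ≤ ⌊2 ^ (n + 1) * t⌋₊ := by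
      apply Nat.le_floor
      push_cast
      rw [pow_succ', mul_assoc]
      gcongr
    have h5 : ⌊2 ^ (n + 1) * t⌋₊ < 2 * m + 2 := by
      rw [Nat.floor_lt (by positivity)]
      push_cast
      rw [pow_succ', mul_assoc]
      calc 2 * (2 ^ n * t) < 2 * (m + 1 : ℝ≥0) := by gcongr
        _ = _ := by ring
    omega
  have h6 : dyadicFloor n t = ((2 * m : ℕ) : ℝ≥0) / 2 ^ (n + 1) := by
    rw [dyadicFloor, ← hm, pow_succ']
    push_cast
    rw [mul_div_mul_left _ _ (by norm_num)]
  rcases h3 with h3 | h3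
  · rw [h6, dyadicFloor, h3]
    simpa using hM0 _
  · rw [h6, dyadicFloor, h3]
    apply h
    have h7 : (m : ℝ≥0) ≤ 2 ^ n * n := h1.trans (by gcongr)
    have h8 : m ≤ 2 ^ n * n := by exact_mod_cast h7
    have : 0 < 2 ^ n := by positivity
    rw [pow_succ']
    nlinarith

/-- Points at distance at most 2^(-n) have level-n floors that are equal or adjacent. -/
lemma abs_dyadicFloor_sub_le (hM0 : ∀ n, 0 ≤ M n)
    (h : ∀ n k : ℕ, k < n * 2 ^ n → |y ((k + 1 : ℕ) / 2 ^ n) - y ((k : ℕ) / 2 ^ n)| ≤ M n)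
    {n : ℕ} {s t : ℝ≥0} (hst : s ≤ t) (hts : t ≤ s + 1 / 2 ^ n) (ht : s < n) :
    |y (dyadicFloor n t) - y (dyadicFloor n s)| ≤ M n := by
  have h1 : ⌊2 ^ n * s⌋₊ ≤ ⌊2 ^ n * t⌋₊ := by gcongr
  have h2 : ⌊2 ^ n * t⌋₊ ≤ ⌊2 ^ n * s⌋₊ + 1 := by
    rw [← Nat.floor_add_one (by positivity)]
    apply Nat.floor_mono
    calc 2 ^ n * t ≤ 2 ^ n * (s + 1 / 2 ^ n) := by gcongr
      _ = _ := by rw [mul_add, mul_one_div, div_self (by positivity)]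
  have h3 : ⌊2 ^ n * t⌋₊ = ⌊2 ^ n * s⌋₊ ∨ ⌊2 ^ n * t⌋₊ = ⌊2 ^ n * s⌋₊ + 1 := by omega
  rcases h3 with h3 | h3
  · simpa [dyadicFloor, h3] using hM0 n
  · rw [dyadicFloor, dyadicFloor, h3]
    apply h
    rw [Nat.floor_lt (by positivity)]
    push_cast
    rw [mul_comm]
    gcongr

/-- If the dyadic increments of `y` are dominated by a summable sequence, the values of `y` at the
dyadic approximations converge to a continuous function. -/
lemma exists_continuous_of_dyadic_increments (hM0 : ∀ n, 0 ≤ M n) (hM : Summable M)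
    (h : ∀ n k : ℕ, k < n * 2 ^ n → |y ((k + 1 : ℕ) / 2 ^ n) - y ((k : ℕ) / 2 ^ n)| ≤ M n) :
    ∃ z : ℝ≥0 → ℝ, Continuous z ∧
      ∀ t, Tendsto (fun n => y (dyadicFloor n t)) atTop (𝓝 (z t)) := by
  have hM1 : Summable fun n => M (n + 1) := (summable_nat_add_iff 1).2 hM
  have key : ∀ t : ℝ≥0, ∃ l : ℝ, Tendsto (fun n => y (dyadicFloor n t)) atTop (𝓝 l) ∧
      ∀ n : ℕ, t ≤ n → |y (dyadicFloor n t) - l| ≤ ∑' m, M (n + m + 1) := by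
    intro t
    obtain ⟨N, hN⟩ := exists_nat_ge t
    have hd : ∀ n : ℕ, dist (y (dyadicFloor (n + N) t)) (y (dyadicFloor (n.succ + N) t)) ≤
        M (n + N + 1) := fun n => by
      rw [dist_comm, Real.dist_eq, Nat.succ_add]
      exact abs_dyadicFloor_succ_sub_le hM0 h (hN.trans (by simp))
    have hc := cauchySeq_of_dist_le_of_summable _ hd
      ((summable_nat_add_iff N).2 hM1)
    obtain ⟨l, hl⟩ := cauchySeq_tendsto_of_complete hc
    have hl' : Tendsto (fun n => y (dyadicFloor n t)) atTop (𝓝 l) :=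
      (tendsto_add_atTop_iff_nat N).1 hl
    refine ⟨l, hl', fun n hn => ?_⟩
    have hd' : ∀ m : ℕ, dist (y (dyadicFloor (n + m) t)) (y (dyadicFloor (n + m.succ) t)) ≤
        M (n + m + 1) := fun m => by
      rw [dist_comm, Real.dist_eq, Nat.add_succ]
      exact abs_dyadicFloor_succ_sub_le hM0 h (hn.trans (by simp))
    have hs : Summable fun m => M (n + m + 1) := by
      have := (summable_nat_add_iff n).2 hM1
      simpa [add_comm, add_left_comm] using this
    have hl2 : Tendsto (fun m => y (dyadicFloor (n + m) t)) atTop (𝓝 l) := by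
      have := (tendsto_add_atTop_iff_nat n).2 hl'
      simpa [add_comm] using this
    have := dist_le_tsum_of_dist_le_of_tendsto₀ _ hd' hs hl2
    simpa [Real.dist_eq] using this
  choose z hz hzM using key
  refine ⟨z, ?_, hz⟩
  have htail : Tendsto (fun n => ∑' m, M (n + m + 1)) atTop (𝓝 0) := by
    have := tendsto_sum_nat_add fun n => M (n + 1)
    refine this.congr fun n => tsum_congr fun m => by congr 1; ring
  have hMlim : Tendsto M atTop (𝓝 0) := hM.tendsto_atTop_zero
  -- Chain from z(t) to its level-n approximation, across one grid step, and back to z(s): two tails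
  -- and one `M n`.
  have hclose : ∀ (n : ℕ) (s t : ℝ≥0), s ≤ t → t ≤ s + 1 / 2 ^ n → t < n →
      |z t - z s| ≤ 2 * ∑' m, M (n + m + 1) + M n := by
    intro n s t hst hts htn
    have h1 := hzM t n htn.le
    have h2 := hzM s n (hst.trans htn.le)
    have h3 := abs_dyadicFloor_sub_le hM0 h hst hts (hst.trans_lt htn)
    rw [abs_le] at *
    constructor <;> linarith
  rw [Metric.continuous_iff]
  intro t ε hε
  have hlim : Tendsto (fun n => 2 * ∑' m, M (n + m + 1) + M n) atTop (𝓝 0) := by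
    simpa using (htail.const_mul 2).add hMlim
  -- The extra 1 leaves room for points to the right of t within distance 1 / 2^n ≤ 1.
  obtain ⟨N, hN⟩ := exists_nat_gt (t + 1)
  obtain ⟨n, hn, hnN⟩ := ((hlim.eventually (gt_mem_nhds hε)).and (eventually_ge_atTop N)).exists
  refine ⟨1 / 2 ^ n, by positivity, fun s hs => ?_⟩
  have hle1 : (1 : ℝ) / 2 ^ n ≤ 1 := by
    rw [div_le_one (by positivity)]
    exact one_le_pow₀ (by norm_num)
  have hNn : (N : ℝ) ≤ n := by exact_mod_cast hnN
  have hN' : (t : ℝ) + 1 < N := by exact_mod_cast hN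
  rw [NNReal.dist_eq, abs_lt] at hs
  rw [Real.dist_eq]
  refine lt_of_le_of_lt ?_ hn
  rcases le_total s t with hst | hst
  · rw [abs_sub_comm]
    refine hclose n s t hst ?_ ?_
    · rw [← NNReal.coe_le_coe]
      push_cast
      linarith
    · rw [← NNReal.coe_lt_coe]
      push_cast
      linarith
  · refine hclose n t s hst ?_ ?_
    · rw [← NNReal.coe_le_coe]
      push_cast
      linarith
    · rw [← NNReal.coe_lt_coe]
      push_cast
      linarith

end Deterministic

open scoped ENNReal

/-- The **Kolmogorov continuity criterion**, in the special case of the exponent `3`. -/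
theorem exists_continuous_modification {Ω : Type*} [MeasurableSpace Ω] {P : Measure Ω}
    {Y : ℝ≥0 → Ω → ℝ} (hY : ∀ t, AEMeasurable (Y t) P) {q : ℝ} (hq : 0 < q) {C : ℝ≥0∞}
    (hC : C ≠ ⊤)
    (h : ∀ s t : ℝ≥0, ∫⁻ ω, ‖Y t ω - Y s ω‖ₑ ^ q ∂P ≤ C * ENNReal.ofReal (|(t : ℝ) - s| ^ 3)) :
    ∃ Z : ℝ≥0 → Ω → ℝ, (∀ ω, Continuous fun t => Z t ω) ∧ ∀ t, Z t =ᵐ[P] Y t := by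
  classical
  have hmeas : ∀ s t, AEMeasurable (fun ω => ‖Y t ω - Y s ω‖ₑ ^ q) P := fun s t =>
    (((hY t).sub (hY s)).enorm).pow_const q
  -- There are n 2^n increments, each with moment at most C 2^(-3n). The weight 2^n therefore leaves
  -- the summable bound C n 2^(-n), while finiteness of ∑ S_n forces every level-n increment to be
  -- at most (A 2^(-n))^(1/q).
  set S : ℕ → Ω → ℝ≥0∞ := fun n ω => 2 ^ n * ∑ k ∈ Finset.range (n * 2 ^ n),
    ‖Y ((k + 1 : ℕ) / 2 ^ n) ω - Y ((k : ℕ) / 2 ^ n) ω‖ₑ ^ q with hS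
  have hSmeas : ∀ n, AEMeasurable (S n) P := fun n =>
    (Finset.aemeasurable_fun_sum _ fun k _ => hmeas _ _).const_mul _
  have hSint : ∀ n, ∫⁻ ω, S n ω ∂P ≤ C * ENNReal.ofReal (n * (1 / 2) ^ n) := by
    intro n
    rw [hS]
    simp only
    rw [lintegral_const_mul'' _ (Finset.aemeasurable_fun_sum _ fun k _ => hmeas _ _),
      lintegral_finsetSum' _ fun k _ => hmeas _ _]
    have : ∀ k ∈ Finset.range (n * 2 ^ n),
        ∫⁻ ω, ‖Y ((k + 1 : ℕ) / 2 ^ n) ω - Y ((k : ℕ) / 2 ^ n) ω‖ₑ ^ q ∂P ≤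
          C * ENNReal.ofReal ((1 / 2) ^ n * (1 / 2) ^ n * (1 / 2) ^ n) := fun k _ => by
      refine (h _ _).trans (le_of_eq ?_)
      congr 2
      push_cast
      rw [← sub_div, add_sub_cancel_left, abs_of_pos (by positivity)]
      simp only [one_div, inv_pow]
      ring
    refine (mul_le_mul_right (Finset.sum_le_sum this) _).trans (le_of_eq ?_)
    rw [Finset.sum_const, Finset.card_range, nsmul_eq_mul, ← mul_assoc, ← mul_assoc,
      mul_comm _ C, mul_assoc]
    congr 1
    have e1 : (2 ^ n * ((n * 2 ^ n : ℕ) : ℝ≥0∞)) = ENNReal.ofReal (2 ^ n * (n * 2 ^ n)) := by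
      rw [ENNReal.ofReal_mul (by positivity), ENNReal.ofReal_mul (by positivity),
        ENNReal.ofReal_pow (by norm_num)]
      simp
    rw [e1, ← ENNReal.ofReal_mul (by positivity)]
    congr 1
    have : (2 : ℝ) ^ n * (1 / 2) ^ n = 1 := by rw [← mul_pow]; norm_num
    linear_combination (n * (1 / 2 : ℝ) ^ n * (2 ^ n * (1 / 2) ^ n + 1)) * this
  have hsum_finite : ∀ f : ℕ → Ω → ℝ≥0∞, (∀ n, AEMeasurable (f n) P) → ∀ u : ℕ → ℝ,
      (∀ n, 0 ≤ u n) → Summable u → (∀ n, ∫⁻ ω, f n ω ∂P ≤ C * ENNReal.ofReal (u n)) →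
      ∀ᵐ ω ∂P, ∑' n, f n ω < ⊤ := by
    intro f hf u hu0 hu hfu
    refine ae_lt_top' (AEMeasurable.tsum hf) ?_
    rw [lintegral_tsum hf]
    refine ne_top_of_le_ne_top ?_ (ENNReal.tsum_le_tsum hfu)
    rw [ENNReal.tsum_mul_left, ← ENNReal.ofReal_tsum_of_nonneg hu0 hu]
    exact ENNReal.mul_ne_top hC ENNReal.ofReal_ne_top
  have hgood : ∀ᵐ ω ∂P, ∑' n, S n ω < ⊤ := by
    refine hsum_finite S hSmeas _ (fun n => by positivity) ?_ hSint
    simpa using summable_pow_mul_geometric_of_norm_lt_one (R := ℝ) 1 (r := 1 / 2) (by norm_num)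
  have hpath : ∀ ω, ∑' n, S n ω < ⊤ → ∃ z : ℝ≥0 → ℝ, Continuous z ∧
      ∀ t, Tendsto (fun n => Y (dyadicFloor n t) ω) atTop (𝓝 (z t)) := by
    intro ω hω
    set A := (∑' n, S n ω).toReal with hA
    have hA0 : 0 ≤ A := ENNReal.toReal_nonneg
    refine exists_continuous_of_dyadic_increments (y := fun t => Y t ω)
      (M := fun n => A ^ (1 / q) * ((1 / 2 : ℝ) ^ (1 / q)) ^ n) (fun n => by positivity) ?_ ?_
    · refine (summable_geometric_of_lt_one (by positivity) ?_).mul_left _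
      exact Real.rpow_lt_one (by norm_num) (by norm_num) (by positivity)
    · intro n k hk
      set x := |Y ((k + 1 : ℕ) / 2 ^ n) ω - Y ((k : ℕ) / 2 ^ n) ω| with hx
      have h1 : ENNReal.ofReal (2 ^ n * x ^ q) ≤ ENNReal.ofReal A := by
        rw [hA, ENNReal.ofReal_toReal hω.ne]
        refine le_trans ?_ (ENNReal.le_tsum n)
        rw [ENNReal.ofReal_mul (by positivity), ENNReal.ofReal_pow (by norm_num),
          ← ENNReal.ofReal_rpow_of_nonneg (abs_nonneg _) hq.le, ← Real.enorm_eq_ofReal_abs]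
        simp only [ENNReal.ofReal_ofNat, hS]
        refine mul_le_mul_right ?_ _
        exact Finset.single_le_sum (f := fun k : ℕ =>
          ‖Y ((k + 1 : ℕ) / 2 ^ n) ω - Y ((k : ℕ) / 2 ^ n) ω‖ₑ ^ q) (fun _ _ => zero_le)
          (Finset.mem_range.2 hk)
      rw [ENNReal.ofReal_le_ofReal_iff hA0] at h1
      have h2 : x ^ q ≤ A * (1 / 2) ^ n := by
        have : (2 : ℝ) ^ n * (1 / 2) ^ n = 1 := by rw [← mul_pow]; norm_num
        have h3 : 0 < (1 / 2 : ℝ) ^ n := by positivity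
        calc x ^ q = (2 ^ n * x ^ q) * (1 / 2) ^ n := by linear_combination -(x ^ q) * this
          _ ≤ _ := by gcongr
      have h3 : x = (x ^ q) ^ (1 / q) := by
        rw [← Real.rpow_mul (abs_nonneg _), mul_one_div_cancel hq.ne', Real.rpow_one]
      rw [h3]
      refine (Real.rpow_le_rpow (by positivity) h2 (by positivity)).trans (le_of_eq ?_)
      rw [Real.mul_rpow hA0 (by positivity), ← Real.rpow_natCast, ← Real.rpow_natCast,
        ← Real.rpow_mul (by norm_num), ← Real.rpow_mul (by norm_num), mul_comm (n : ℝ)]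
  choose! z hzc hz using hpath
  -- The zero path on the exceptional null set makes every path continuous.
  refine ⟨fun t ω => if ∑' n, S n ω < ⊤ then z ω t else 0, fun ω => ?_, fun t => ?_⟩
  · by_cases hω : ∑' n, S n ω < ⊤
    · simpa [hω] using hzc ω hω
    · simp only [hω, if_false]
      exact continuous_const
  -- For fixed t the moments of Y(dyadicFloor n t) - Y(t) are summable, so the dyadic values also
  -- converge almost surely to Y(t), which identifies the limit.
  · have hconv : ∀ᵐ ω ∂P, ∑' n, ‖Y (dyadicFloor n t) ω - Y t ω‖ₑ ^ q < ⊤ := by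
      refine hsum_finite (fun n ω => ‖Y (dyadicFloor n t) ω - Y t ω‖ₑ ^ q) (fun n => hmeas _ _)
        (fun n => (1 / 8) ^ n) (fun n => by positivity)
        (summable_geometric_of_lt_one (by norm_num) (by norm_num)) fun n => ?_
      refine (h _ _).trans (mul_le_mul_right (ENNReal.ofReal_le_ofReal ?_) _)
      have h1 : (dyadicFloor n t : ℝ) ≤ t := by exact_mod_cast dyadicFloor_le n t
      have h2 : (t : ℝ) < dyadicFloor n t + 1 / 2 ^ n := by exact_mod_cast lt_dyadicFloor_add n t
      have h3 : |(dyadicFloor n t : ℝ) - t| ≤ (1 / 2) ^ n := by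
        rw [one_div_pow, abs_le]
        constructor <;> linarith [show (0 : ℝ) < 1 / 2 ^ n by positivity]
      calc |(dyadicFloor n t : ℝ) - t| ^ 3 ≤ ((1 / 2) ^ n) ^ 3 := by gcongr
        _ = (1 / 8) ^ n := by rw [← pow_mul, mul_comm, pow_mul]; norm_num
    filter_upwards [hgood, hconv] with ω hω hω'
    simp only [hω, if_true]
    refine tendsto_nhds_unique (hz ω hω t) ?_
    have h1 := ENNReal.tendsto_atTop_zero_of_tsum_ne_top hω'.ne
    have h2 : Tendsto (fun n => ‖Y (dyadicFloor n t) ω - Y t ω‖ₑ) atTop (𝓝 0) := by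
      have h3 := h1.ennrpow_const (1 / q)
      rw [ENNReal.zero_rpow_of_pos (by positivity)] at h3
      refine h3.congr fun n => ?_
      rw [← ENNReal.rpow_mul, mul_one_div_cancel hq.ne', ENNReal.rpow_one]
    rw [tendsto_iff_edist_tendsto_0]
    simpa [edist_eq_enorm_sub] using h2

end Kolmogorov

/-! ### Plancherel's theorem on L¹ ∩ L². -/

section Plancherel

open FourierTransform SchwartzMap TemperedDistribution
open scoped ContDiff

/-- On `L¹ ∩ L²` the `L²` Fourier transform is given by the Fourier integral. -/
theorem coeFn_fourier_toLp_ae_eq {f : ℝ → ℂ} (hf : Integrable f) (hf2 : MemLp f 2) :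
    ((𝓕 (hf2.toLp f) : Lp ℂ 2 (volume : Measure ℝ)) : ℝ → ℂ) =ᵐ[volume] 𝓕 f := by
  have hcont : Continuous (𝓕 f) :=
    VectorFourier.fourierIntegral_continuous Real.continuous_fourierChar
      (by exact continuous_inner) hf
  -- Test against smooth compactly supported functions: both transforms can be moved onto the test
  -- function, one by the definition for tempered distributions and the other by Fubini.
  refine ae_eq_of_integral_contDiff_smul_eq
    ((Lp.memLp _).locallyIntegrable (by norm_num)) hcont.locallyIntegrable ?_
  intro g g_smooth g_cpt
  have hg₁ : HasCompactSupport (Complex.ofRealCLM ∘ g) := g_cpt.comp_left rfl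
  have hg₂ : ContDiff ℝ ∞ (Complex.ofRealCLM ∘ g) := by fun_prop
  set φ : 𝓢(ℝ, ℂ) := hg₁.toSchwartzMap hg₂ with hφ
  have hφg : ∀ x, φ x = g x := fun x => by simp [hφ]
  have h1 : ∫ x, φ x • (𝓕 (hf2.toLp f) : Lp ℂ 2 (volume : Measure ℝ)) x =
      ∫ x, (𝓕 φ : 𝓢(ℝ, ℂ)) x • (hf2.toLp f : Lp ℂ 2 (volume : Measure ℝ)) x := by
    rw [← Lp.toTemperedDistribution_apply, ← Lp.toTemperedDistribution_apply,
      ← Lp.fourier_toTemperedDistribution_eq, TemperedDistribution.fourier_apply]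
  have h2 : ∫ x, (𝓕 φ : 𝓢(ℝ, ℂ)) x • (hf2.toLp f : Lp ℂ 2 (volume : Measure ℝ)) x =
      ∫ x, (𝓕 φ : 𝓢(ℝ, ℂ)) x • f x := by
    refine integral_congr_ae ?_
    filter_upwards [hf2.coeFn_toLp] with x hx
    rw [hx]
  have h3 : ∫ x, (𝓕 φ : 𝓢(ℝ, ℂ)) x • f x = ∫ x, φ x • 𝓕 f x := by
    have := VectorFourier.integral_fourierIntegral_smul_eq_flip (μ := volume) (ν := volume)
      (L := innerₗ ℝ) Real.continuous_fourierChar (by exact continuous_inner) φ.integrable hf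
    simp only [flip_innerₗ] at this
    exact this
  have h4 := h1.trans (h2.trans h3)
  simpa only [hφg, Complex.real_smul, smul_eq_mul] using h4

/-- The Fourier integral of a function in `L¹ ∩ L²` is square integrable. -/
theorem memLp_fourier_two {f : ℝ → ℂ} (hf : Integrable f) (hf2 : MemLp f 2) :
    MemLp (𝓕 f) 2 :=
  (memLp_congr_ae (coeFn_fourier_toLp_ae_eq hf hf2)).1 (Lp.memLp _)

/-- **Plancherel's theorem** for functions in `L¹ ∩ L²`. -/
theorem integral_inner_fourier {f g : ℝ → ℂ} (hf : Integrable f) (hf2 : MemLp f 2)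
    (hg : Integrable g) (hg2 : MemLp g 2) :
    ∫ x, inner ℂ (𝓕 f x) (𝓕 g x) = ∫ x, inner ℂ (f x) (g x) := by
  have h := Lp.inner_fourier_eq (hf2.toLp f) (hg2.toLp g)
  rw [L2.inner_def, L2.inner_def] at h
  have h1 : ∫ x, inner ℂ (𝓕 f x) (𝓕 g x) =
      ∫ x, inner ℂ ((𝓕 (hf2.toLp f) : Lp ℂ 2 (volume : Measure ℝ)) x)
        ((𝓕 (hg2.toLp g) : Lp ℂ 2 (volume : Measure ℝ)) x) := by
    refine integral_congr_ae ?_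
    filter_upwards [coeFn_fourier_toLp_ae_eq hf hf2, coeFn_fourier_toLp_ae_eq hg hg2] with x h1 h2
    rw [h1, h2]
  rw [h1, h]
  refine integral_congr_ae ?_
  filter_upwards [hf2.coeFn_toLp, hg2.coeFn_toLp] with x h1 h2
  rw [h1, h2]

end Plancherel

/-! ### The stable kernel and its L² pairings. -/

section StableKernel

open Real

variable {α a b : ℝ}

lemma integrable_exp_neg_mul_abs_rpow (hα : 0 < α) (ha : 0 < a) :
    Integrable fun ξ : ℝ => exp (-(a * |ξ| ^ α / 2)) := by
  have h1 : IntegrableOn (fun ξ : ℝ => exp (-(a * |ξ| ^ α / 2))) (Ioi 0) := by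
    refine (integrableOn_rpow_mul_exp_neg_mul_rpow (s := 0) (by norm_num) hα
      (half_pos ha)).congr_fun (fun x hx => ?_) measurableSet_Ioi
    simp only [rpow_zero, one_mul, abs_of_pos (mem_Ioi.1 hx)]
    congr 1
    ring
  have h2 : IntegrableOn (fun ξ : ℝ => exp (-(a * |ξ| ^ α / 2))) (Iic 0) := by
    have h3 := (integrableOn_Ici_iff_integrableOn_Ioi (by simp)).2 h1
    have h4 := ((Measure.measurePreserving_neg (volume : Measure ℝ)).integrableOn_comp_preimage
      (Homeomorph.neg ℝ).measurableEmbedding).2 h3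
    simpa [Function.comp_def] using h4
  rw [← integrableOn_univ, ← Iic_union_Ioi (a := (0 : ℝ))]
  exact h2.union h1

lemma integral_exp_neg_mul_abs_rpow (hα : 0 < α) (ha : 0 < a) :
    ∫ ξ : ℝ, exp (-(a * |ξ| ^ α / 2)) = 2 * ((a / 2) ^ (-1 / α) * Gamma (1 / α + 1)) := by
  rw [integral_comp_abs (f := fun x => exp (-(a * x ^ α / 2))),
    ← integral_exp_neg_mul_rpow hα (half_pos ha)]
  congr 1
  refine integral_congr_ae (Filter.Eventually.of_forall fun x => ?_)
  simp only
  congr 1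
  ring

/-- The characteristic function of the stable law, rescaled so that its Fourier transform is the
kernel. -/
noncomputable def stableSymbol (α a : ℝ) (v : ℝ) : ℝ := exp (-(a * |2 * π * v| ^ α / 2))

lemma integrable_stableSymbol (hα : 0 < α) (ha : 0 < a) : Integrable (stableSymbol α a) :=
  (integrable_exp_neg_mul_abs_rpow hα ha).comp_mul_left' (by positivity)

lemma stableSymbol_mul (v : ℝ) :
    stableSymbol α a v * stableSymbol α b v = stableSymbol α (a + b) v := by
  rw [stableSymbol, stableSymbol, stableSymbol, ← exp_add]
  congr 1
  ring

lemma memLp_stableSymbol (hα : 0 < α) (ha : 0 < a) : MemLp (stableSymbol α a) 2 := by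
  rw [memLp_two_iff_integrable_sq (integrable_stableSymbol hα ha).1]
  simp_rw [sq, stableSymbol_mul]
  exact integrable_stableSymbol hα (by positivity)

lemma integral_stableSymbol (hα : 0 < α) (ha : 0 < a) :
    ∫ v, stableSymbol α a v = π⁻¹ * ((a / 2) ^ (-1 / α) * Gamma (1 / α + 1)) := by
  have := Measure.integral_comp_mul_left (fun ξ : ℝ => exp (-(a * |ξ| ^ α / 2))) (2 * π)
  simp only [stableSymbol]
  rw [this, integral_exp_neg_mul_abs_rpow hα ha, abs_of_pos (by positivity)]
  simp only [smul_eq_mul]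
  field_simp

-- The factor 2π in the symbol matches the normalization exp(-2πivx) of `𝓕`; the sine part vanishes
-- because the symbol is even.
open FourierTransform in
lemma fourier_stableSymbol (hα : 0 < α) (ha : 0 < a) (x : ℝ) :
    𝓕 (fun v => (stableSymbol α a v : ℂ)) x = (stableKernel α a x : ℂ) := by
  have hi := integrable_stableSymbol hα ha
  have hc : Integrable fun v => cos (2 * π * v * x) * stableSymbol α a v :=
    hi.bdd_mul (c := 1) (by fun_prop) (Filter.Eventually.of_forall fun v => abs_cos_le_one _)
  have hs : Integrable fun v => sin (2 * π * v * x) * stableSymbol α a v :=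
    hi.bdd_mul (c := 1) (by fun_prop) (Filter.Eventually.of_forall fun v => abs_sin_le_one _)
  have hs0 : ∫ v, sin (2 * π * v * x) * stableSymbol α a v = 0 := by
    have h := integral_neg_eq_self (fun v => sin (2 * π * v * x) * stableSymbol α a v) volume
    have h' : ∀ v : ℝ, sin (2 * π * -v * x) * stableSymbol α a (-v) =
        -(sin (2 * π * v * x) * stableSymbol α a v) := fun v => by
      have e1 : 2 * π * -v * x = -(2 * π * v * x) := by ring
      rw [e1, sin_neg, stableSymbol, stableSymbol, mul_neg, abs_neg]
      ring
    simp_rw [h', integral_neg] at h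
    linarith
  have hk : stableKernel α a x = ∫ v, cos (2 * π * v * x) * stableSymbol α a v := by
    have := Measure.integral_comp_mul_left
      (fun ξ : ℝ => cos (ξ * x) * exp (-(a * |ξ| ^ α / 2))) (2 * π)
    simp only [stableSymbol, stableKernel]
    rw [this, abs_of_pos (by positivity)]
    rfl
  rw [Real.fourier_real_eq_integral_exp_smul, hk, ← integral_complex_ofReal]
  have hsplit : ∀ v : ℝ, Complex.exp (↑(-2 * π * v * x) * Complex.I) • (stableSymbol α a v : ℂ) =
      ((cos (2 * π * v * x) * stableSymbol α a v : ℝ) : ℂ) -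
        Complex.I * ((sin (2 * π * v * x) * stableSymbol α a v : ℝ) : ℂ) := fun v => by
    have e1 : (-2 * π * v * x) = -(2 * π * v * x) := by ring
    rw [e1, Complex.exp_mul_I, ← Complex.ofReal_cos, ← Complex.ofReal_sin, cos_neg, sin_neg]
    push_cast
    rw [smul_eq_mul]
    ring
  simp_rw [hsplit]
  rw [integral_sub hc.ofReal (hs.ofReal.const_mul _), integral_const_mul,
    integral_complex_ofReal (f := fun v => sin (2 * π * v * x) * stableSymbol α a v), hs0]
  simp

/-- The constant in `∫ p_a p_b = stableConst α * (a + b) ^ (-1 / α)`. -/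
noncomputable def stableConst (α : ℝ) : ℝ := π⁻¹ * ((1 / 2) ^ (-1 / α) * Gamma (1 / α + 1))

lemma memLp_stableKernel (hα : 0 < α) (ha : 0 < a) : MemLp (stableKernel α a) 2 := by
  have h := (memLp_fourier_two (integrable_stableSymbol hα ha).ofReal
    (memLp_stableSymbol hα ha).ofReal).re
  refine (memLp_congr_ae (Filter.Eventually.of_forall fun x => ?_)).1 h
  simp only [RCLike.re_eq_complex_re]
  erw [fourier_stableSymbol hα ha x]
  exact Complex.ofReal_re _

/-- Plancherel replaces the kernels by their symbols, whose product is the symbol at a + b; what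
remains is a Gamma integral. -/
lemma integral_stableKernel_mul (hα : 0 < α) (ha : 0 < a) (hb : 0 < b) :
    ∫ x, stableKernel α a x * stableKernel α b x = stableConst α * (a + b) ^ (-1 / α) := by
  have h := integral_inner_fourier (integrable_stableSymbol hα ha).ofReal
    (memLp_stableSymbol hα ha).ofReal (integrable_stableSymbol hα hb).ofReal
    (memLp_stableSymbol hα hb).ofReal
  have h1 : ∀ x : ℝ, inner ℂ (FourierTransform.fourier (fun v => (stableSymbol α a v : ℂ)) x)
      (FourierTransform.fourier (fun v => (stableSymbol α b v : ℂ)) x) =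
      ((stableKernel α a x * stableKernel α b x : ℝ) : ℂ) := fun x => by
    rw [fourier_stableSymbol hα ha, fourier_stableSymbol hα hb]
    simp [mul_comm]
  have h2 : ∀ x : ℝ, inner ℂ (stableSymbol α a x : ℂ) (stableSymbol α b x : ℂ) =
      (stableSymbol α (a + b) x : ℂ) := fun x => by
    rw [← stableSymbol_mul]
    simp [mul_comm]
  have h3 : ∫ x, ((stableKernel α a x * stableKernel α b x : ℝ) : ℂ) =
      ∫ x, (stableSymbol α (a + b) x : ℂ) := by
    simp_rw [← h1, ← h2]
    exact h
  rw [integral_complex_ofReal, integral_complex_ofReal, Complex.ofReal_inj] at h3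
  have hab : 0 < a + b := by positivity
  rw [h3, integral_stableSymbol hα hab, stableConst, div_eq_mul_one_div (a + b) 2,
    mul_rpow hab.le (by norm_num)]
  ring

lemma measurable_stableKernel (α : ℝ) :
    Measurable fun p : ℝ × ℝ => stableKernel α p.1 p.2 := by
  have h : StronglyMeasurable fun p : (ℝ × ℝ) × ℝ =>
      cos (p.2 * p.1.2) * exp (-(p.1.1 * |p.2| ^ α / 2)) :=
    Measurable.stronglyMeasurable (by fun_prop)
  exact (h.integral_prod_right'.measurable).const_mul _

end StableKernel

/-! ### The covariance of the mild solution. -/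

section MildIntegrand

open Real

variable {α : ℝ}

lemma measurable_mildIntegrand (α t x : ℝ) : Measurable (mildIntegrand α t x) := by
  have hg : Measurable fun q : ℝ × ℝ => (t - q.1, q.2 - x) := by fun_prop
  have h : mildIntegrand α t x = ({q : ℝ × ℝ | 0 < q.1} ∩ {q | q.1 < t}).indicator
      ((fun p : ℝ × ℝ => stableKernel α p.1 p.2) ∘ fun q : ℝ × ℝ => (t - q.1, q.2 - x)) := by
    ext q
    simp [mildIntegrand, indicator]
  rw [h]
  exact ((measurable_stableKernel α).comp hg).indicator
    ((measurableSet_lt measurable_const measurable_fst).inter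
      (measurableSet_lt measurable_fst measurable_const))

lemma memLp_mildIntegrand_slice (hα : 0 < α) (t x r : ℝ) :
    MemLp (fun y => mildIntegrand α t x (r, y)) 2 := by
  by_cases hr : 0 < r ∧ r < t
  · simp only [mildIntegrand, hr, and_self, if_true]
    exact (memLp_stableKernel hα (sub_pos.2 hr.2)).comp_measurePreserving
      (f := fun y => y - x) (measurePreserving_sub_right volume x)
  · simp [mildIntegrand, hr]

lemma integral_mildIntegrand_slice (hα : 0 < α) (s t x r : ℝ) :
    ∫ y, mildIntegrand α s x (r, y) * mildIntegrand α t x (r, y) =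
      (Ioo 0 (min s t)).indicator (fun r => stableConst α * (s + t - 2 * r) ^ (-1 / α)) r := by
  by_cases hr : r ∈ Ioo 0 (min s t)
  · have h1 := hr.1
    have h2 := lt_min_iff.1 hr.2
    rw [indicator_of_mem hr]
    simp only [mildIntegrand, h1, h2.1, h2.2, and_self, if_true]
    rw [integral_sub_right_eq_self (fun y => stableKernel α (s - r) y * stableKernel α (t - r) y),
      integral_stableKernel_mul hα (sub_pos.2 h2.1) (sub_pos.2 h2.2)]
    congr 2
    ring
  · rw [indicator_of_notMem hr]
    have : ∀ y, mildIntegrand α s x (r, y) * mildIntegrand α t x (r, y) = 0 := fun y => by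
      simp only [mem_Ioo, lt_min_iff, not_and_or, not_lt] at hr
      simp only [mildIntegrand]
      rcases hr with hr | hr | hr <;> simp [hr.not_gt]
    simp [this]

/-- For s = t the integrand is singular at the endpoint r = t; it is integrable because α > 1 gives
-1/α > -1. -/
lemma integrableOn_slice_indicator (hα : 1 < α) {s t : ℝ} (hs : 0 ≤ s) (ht : 0 ≤ t) :
    IntegrableOn (fun r : ℝ => stableConst α * (s + t - 2 * r) ^ (-1 / α)) (Ioo 0 (min s t)) := by
  have he : -1 < -1 / α := by
    rw [neg_div, neg_lt_neg_iff, div_lt_one (by positivity)]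
    exact hα
  have h := (intervalIntegral.intervalIntegrable_rpow' he (a := s + t)
    (b := s + t - 2 * min s t))
  have h2 := (h.comp_sub_left (s + t)).comp_mul_left (c := 2)
  simp only [sub_self, sub_sub_cancel, zero_div] at h2
  rw [mul_div_cancel_left₀ _ (by norm_num)] at h2
  exact ((intervalIntegrable_iff_integrableOn_Ioo_of_le (le_min hs ht)).1 h2).const_mul _

lemma memLp_mildIntegrand (hα : 1 < α) {t : ℝ} (ht : 0 ≤ t) (x : ℝ) :
    MemLp (mildIntegrand α t x) 2 spaceTimeMeasure := by
  have hα0 : 0 < α := by positivity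
  have hm := (measurable_mildIntegrand α t x).aestronglyMeasurable (μ := spaceTimeMeasure)
  rw [memLp_two_iff_integrable_sq hm]
  have hm2 := hm.pow 2
  rw [spaceTimeMeasure] at hm2 ⊢
  refine (integrable_prod_iff hm2).2 ⟨Filter.Eventually.of_forall fun r => ?_, ?_⟩
  · exact (memLp_mildIntegrand_slice hα0 t x r).integrable_sq
  · have : ∀ r, ∫ y, ‖mildIntegrand α t x (r, y) ^ 2‖ =
        (Ioo 0 (min t t)).indicator (fun r => stableConst α * (t + t - 2 * r) ^ (-1 / α)) r :=
      fun r => by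
        rw [← integral_mildIntegrand_slice hα0 t t x r]
        refine integral_congr_ae (Filter.Eventually.of_forall fun y => ?_)
        simp [sq]
    simp only [Pi.pow_apply, this]
    refine Integrable.restrict ?_
    rw [integrable_indicator_iff measurableSet_Ioo]
    exact integrableOn_slice_indicator hα ht ht

/-- After integration in space, u = s + t - 2r runs from s + t down to s + t - 2 min(s,t) = |s-t|,
and u^(-1/α) integrates to a multiple of u^((α-1)/α). -/
lemma integral_mildIntegrand_mul (hα : 1 < α) {s t : ℝ} (hs : 0 ≤ s) (ht : 0 ≤ t) (x : ℝ) :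
    ∫ q, mildIntegrand α s x q * mildIntegrand α t x q ∂spaceTimeMeasure =
      stableConst α * (((α - 1) / α)⁻¹ / 2) *
        ((s + t) ^ ((α - 1) / α) - |s - t| ^ ((α - 1) / α)) := by
  have hα0 : 0 < α := by positivity
  have hi : Integrable (fun q => mildIntegrand α s x q * mildIntegrand α t x q)
      spaceTimeMeasure :=
    (memLp_mildIntegrand hα hs x).integrable_mul (memLp_mildIntegrand hα ht x)
  have he : -1 < -1 / α := by
    rw [neg_div, neg_lt_neg_iff, div_lt_one (by positivity)]
    exact hα
  have he1 : -1 / α + 1 = (α - 1) / α := by field_simp; ring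
  rw [spaceTimeMeasure] at hi ⊢
  rw [integral_prod _ hi]
  simp_rw [integral_mildIntegrand_slice hα0]
  rw [setIntegral_indicator measurableSet_Ioo, inter_eq_right.2 Ioo_subset_Ioi_self,
    ← integral_Ioc_eq_integral_Ioo, ← intervalIntegral.integral_of_le (le_min hs ht),
    intervalIntegral.integral_const_mul,
    intervalIntegral.integral_comp_sub_mul (fun r => r ^ (-1 / α)) (by norm_num) (s + t),
    integral_rpow (Or.inl he), he1]
  have h2 : s + t - 2 * min s t = |s - t| := by
    rcases le_total s t with h | h
    · rw [min_eq_left h, abs_of_nonpos (by linarith)]; ring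
    · rw [min_eq_right h, abs_of_nonneg (by linarith)]; ring
  rw [h2, mul_zero, sub_zero, smul_eq_mul]
  ring

lemma stableConst_eq (hα : 1 < α) :
    stableConst α * (((α - 1) / α)⁻¹ / 2) = cAlpha α ^ 2 * 2 ^ (-((α - 1) / α)) := by
  have hα0 : 0 < α := by positivity
  have hα1 : 0 < α - 1 := by linarith
  have hΓ : 0 < Gamma (1 / α) := Gamma_pos_of_pos (by positivity)
  have e : (2 : ℝ) ^ (-((α - 1) / α)) = 2⁻¹ * 2 ^ (1 / α) := by
    rw [← rpow_neg_one, ← rpow_add (by norm_num)]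
    congr 1
    field_simp
    ring
  have e' : (1 / 2 : ℝ) ^ (-1 / α) = 2 ^ (1 / α) := by
    rw [one_div, inv_rpow (by norm_num), ← rpow_neg (by norm_num)]
    congr 1
    ring
  rw [cAlpha, sq_sqrt (by positivity), stableConst, Gamma_add_one (by positivity), e, e']
  field_simp

/-- The integrand of the mild solution as an element of `L²((0, ∞) × ℝ)`. -/
noncomputable def mildElement (hα : 1 < α) (x : ℝ) (t : ℝ≥0) : Lp ℝ 2 spaceTimeMeasure :=
  (memLp_mildIntegrand hα t.coe_nonneg x).toLp (mildIntegrand α t x)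

lemma inner_mildElement (hα : 1 < α) (x : ℝ) (s t : ℝ≥0) :
    inner ℝ (mildElement hα x s) (mildElement hα x t) =
      cAlpha α ^ 2 * 2 ^ (-((α - 1) / α)) *
        (((s : ℝ) + t) ^ ((α - 1) / α) - |(s : ℝ) - t| ^ ((α - 1) / α)) := by
  rw [← stableConst_eq hα, ← integral_mildIntegrand_mul hα s.coe_nonneg t.coe_nonneg x, L2.inner_def]
  refine integral_congr_ae ?_
  filter_upwards [(memLp_mildIntegrand hα s.coe_nonneg x).coeFn_toLp,
    (memLp_mildIntegrand hα t.coe_nonneg x).coeFn_toLp] with q h1 h2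
  rw [mildElement, mildElement, h1, h2]
  simp [mul_comm]

lemma norm_mildElement_sub_sq_le (hα : 1 < α) (x : ℝ) (s t : ℝ≥0) :
    ‖mildElement hα x t - mildElement hα x s‖ ^ 2 ≤
      2 * (cAlpha α ^ 2 * 2 ^ (-((α - 1) / α))) * |(t : ℝ) - s| ^ ((α - 1) / α) := by
  set K := (α - 1) / α with hK
  have hα0 : 0 < α := by positivity
  have hK0 : 0 < K := div_pos (by linarith) hα0
  have hK1 : K ≤ 1 := by rw [hK, div_le_one hα0]; linarith
  -- Midpoint concavity of u^K at 2t and 2s: the part of the increment variance that does not depend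
  -- on |t-s| alone is nonpositive.
  have hc : ((t : ℝ) + t) ^ K + ((s : ℝ) + s) ^ K ≤ 2 * ((t : ℝ) + s) ^ K := by
    have := (concaveOn_rpow hK0.le hK1).2 (mem_Ici.2 (show 0 ≤ (t : ℝ) + t by positivity))
      (mem_Ici.2 (show 0 ≤ (s : ℝ) + s by positivity)) (show (0 : ℝ) ≤ 1 / 2 by norm_num)
      (show (0 : ℝ) ≤ 1 / 2 by norm_num) (by norm_num)
    simp only [smul_eq_mul] at this
    have e : 1 / 2 * ((t : ℝ) + t) + 1 / 2 * (s + s) = t + s := by ring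
    rw [e] at this
    linarith
  rw [norm_sub_sq_real, ← real_inner_self_eq_norm_sq, ← real_inner_self_eq_norm_sq,
    inner_mildElement, inner_mildElement, inner_mildElement]
  rw [← hK]
  simp only [sub_self, abs_zero, zero_rpow hK0.ne', sub_zero]
  have hC : 0 ≤ cAlpha α ^ 2 * 2 ^ (-K) := by positivity
  nlinarith [mul_le_mul_of_nonneg_left hc hC]

lemma wienerIntegral_mildIntegrand {Ω : Type*} [MeasurableSpace Ω] (hα : 1 < α)
    (W : Lp ℝ 2 spaceTimeMeasure → Ω → ℝ) (t : ℝ≥0) (x : ℝ) :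
    wienerIntegral W (mildIntegrand α t x) = W (mildElement hα x t) := by
  rw [wienerIntegral, dif_pos (memLp_mildIntegrand hα t.coe_nonneg x), mildElement]

end MildIntegrand

/-! ### Expansion of (s+t)^(-p) by the binomial series and the Cayley transform. -/

section BinomialKernel

open Real Filter Topology

/-- The coefficients of the power series of `(1 - x) ^ (-p)`. -/
noncomputable def negBinomialCoeff (p : ℝ) (k : ℕ) : ℝ := Ring.choose (p + k - 1) k

/-- The coefficient is p(p+1)⋯(p+k-1)/k!. Its sign permits splitting it as a product of two square
roots. -/
lemma negBinomialCoeff_nonneg {p : ℝ} (hp : 0 < p) (k : ℕ) : 0 ≤ negBinomialCoeff p k := by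
  rw [negBinomialCoeff, ← Ring.multichoose_eq]
  have h := Ring.factorial_nsmul_multichoose_eq_ascPochhammer p k
  rw [Polynomial.ascPochhammer_smeval_eq_eval, nsmul_eq_mul] at h
  have h1 := ascPochhammer_pos (S := ℝ) k p hp
  rw [← h] at h1
  exact (pos_of_mul_pos_right h1 (by positivity)).le

lemma hasSum_negBinomialCoeff (p : ℝ) {x : ℝ} (hx : |x| < 1) :
    HasSum (fun k => negBinomialCoeff p k * x ^ k) (1 / (1 - x) ^ p) := by
  have h := (one_div_one_sub_rpow_hasFPowerSeriesOnBall_zero p).hasSum (y := x)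
    (by simpa [← ENNReal.coe_one, ← NNReal.coe_lt_coe] using hx)
  simpa [FormalMultilinearSeries.ofScalars_apply_eq, negBinomialCoeff, mul_comm] using h

lemma summable_sqrt_negBinomialCoeff {p : ℝ} (hp : 0 < p) {ρ : ℝ} (h0 : 0 ≤ ρ) (h1 : ρ < 1) :
    Summable fun k => √(negBinomialCoeff p k) * ρ ^ k := by
  have hs1 := (hasSum_negBinomialCoeff p (x := ρ) (by rwa [abs_of_nonneg h0])).summable
  have hs2 := summable_geometric_of_lt_one h0 h1
  refine Summable.of_nonneg_of_le (fun k => by positivity) (fun k => ?_) (hs1.add hs2)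
  -- This compares the series with the sum of the binomial and geometric series.
  have h2 : √(negBinomialCoeff p k) ≤ negBinomialCoeff p k + 1 := by
    nlinarith [sq_sqrt (negBinomialCoeff_nonneg hp k), sq_nonneg (√(negBinomialCoeff p k) - 1),
      sqrt_nonneg (negBinomialCoeff p k)]
  calc _ ≤ (negBinomialCoeff p k + 1) * ρ ^ k := by gcongr
    _ = _ := by ring

/-- A power series whose terms are absolutely summable on the unit interval is smooth there. -/
lemma contDiffOn_tsum_mul_pow {d : ℕ → ℝ}
    (hd : ∀ ρ : ℝ, 0 ≤ ρ → ρ < 1 → Summable fun k => |d k| * ρ ^ k) {n : WithTop ℕ∞} :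
    ContDiffOn ℝ n (fun u => ∑' k, d k * u ^ k) (Metric.ball 0 1) := by
  set q := FormalMultilinearSeries.ofScalars ℝ d with hq
  have hr : 1 ≤ q.radius := by
    refine ENNReal.le_of_forall_nnreal_lt fun r hr => ?_
    have hr' : (r : ℝ) < 1 := by exact_mod_cast hr
    refine q.le_radius_of_summable_norm ?_
    simpa [hq] using hd r r.coe_nonneg hr'
  have h := (q.hasFPowerSeriesOnBall (lt_of_lt_of_le one_pos hr)).analyticOnNhd
  have h2 : ContDiffOn ℝ n q.sum (Metric.eball 0 1) :=
    (h.mono (Metric.eball_subset_eball hr)).contDiffOn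
      Metric.isOpen_eball.uniqueDiffOn
  have e : q.sum = fun u => ∑' k, d k * u ^ k := by
    ext u
    have := FormalMultilinearSeries.ofScalars_sum_eq (𝕜 := ℝ) d u
    simpa [FormalMultilinearSeries.ofScalarsSum, hq] using this
  rw [e] at h2
  have e2 : Metric.eball (0 : ℝ) 1 = Metric.ball 0 1 := by
    rw [← ENNReal.ofReal_one, Metric.eball_ofReal]
  rwa [e2] at h2

/-- The functions `b_k` on the half line with `∑ b_k(s) b_k(t) = β ^ 2 * 2 ^ p * (s + t) ^ (-p)`,
obtained from the binomial series through the Cayley transform `s ↦ (s - 1) / (s + 1)`. -/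
noncomputable def cayleyFun (β p : ℝ) (k : ℕ) (s : ℝ) : ℝ :=
  (Ioi (0 : ℝ)).indicator
    (fun s => β * (2 / (s + 1)) ^ p * (√(negBinomialCoeff p k) * ((s - 1) / (s + 1)) ^ k)) s

variable {β p : ℝ}

lemma abs_cayley_lt_one {s : ℝ} (hs : 0 < s) : |(s - 1) / (s + 1)| < 1 := by
  rw [abs_div, abs_of_pos (show 0 < s + 1 by positivity), div_lt_one (by positivity), abs_lt]
  constructor <;> linarith

lemma cayleyFun_of_pos {s : ℝ} (hs : 0 < s) (k : ℕ) :
    cayleyFun β p k s =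
      β * (2 / (s + 1)) ^ p * (√(negBinomialCoeff p k) * ((s - 1) / (s + 1)) ^ k) :=
  indicator_of_mem (mem_Ioi.2 hs) _

lemma cayleyFun_of_nonpos {s : ℝ} (hs : s ≤ 0) (k : ℕ) : cayleyFun β p k s = 0 :=
  indicator_of_notMem (by simpa using hs) _

lemma measurable_cayleyFun (k : ℕ) : Measurable (cayleyFun β p k) :=
  Measurable.indicator (by fun_prop) measurableSet_Ioi

/-- With u = (s-1)/(s+1) and w = (t-1)/(t+1) one has 1 - uw = 2(s+t)/((s+1)(t+1)); the prefactors
(2/(s+1))^p and (2/(t+1))^p turn (1-uw)^(-p) into (2/(s+t))^p. -/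
lemma hasSum_cayleyFun_mul (hp : 0 < p) {s t : ℝ} (hs : 0 < s) (ht : 0 < t) :
    HasSum (fun k => cayleyFun β p k s * cayleyFun β p k t) (β ^ 2 * 2 ^ p * (s + t) ^ (-p)) := by
  have hx : |(s - 1) / (s + 1) * ((t - 1) / (t + 1))| < 1 := by
    rw [abs_mul]
    exact mul_lt_one_of_nonneg_of_lt_one_left (abs_nonneg _) (abs_cayley_lt_one hs)
      (abs_cayley_lt_one ht).le
  have h := (hasSum_negBinomialCoeff p hx).mul_left
    (β ^ 2 * ((2 / (s + 1)) ^ p * (2 / (t + 1)) ^ p))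
  have hxs : 0 < 1 - (s - 1) / (s + 1) * ((t - 1) / (t + 1)) := by
    linarith [(abs_lt.1 hx).2]
  have hterm : ∀ k, cayleyFun β p k s * cayleyFun β p k t =
      β ^ 2 * ((2 / (s + 1)) ^ p * (2 / (t + 1)) ^ p) *
        (negBinomialCoeff p k * ((s - 1) / (s + 1) * ((t - 1) / (t + 1))) ^ k) := fun k => by
    rw [cayleyFun_of_pos hs, cayleyFun_of_pos ht, mul_pow]
    have := mul_self_sqrt (negBinomialCoeff_nonneg hp k)
    linear_combination (β ^ 2 * (2 / (s + 1)) ^ p * (2 / (t + 1)) ^ p *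
      (((s - 1) / (s + 1)) ^ k * ((t - 1) / (t + 1)) ^ k)) * this
  have hval : β ^ 2 * ((2 / (s + 1)) ^ p * (2 / (t + 1)) ^ p) *
      (1 / (1 - (s - 1) / (s + 1) * ((t - 1) / (t + 1))) ^ p) =
      β ^ 2 * 2 ^ p * (s + t) ^ (-p) := by
    rw [mul_assoc (β ^ 2) _ (1 / _), mul_assoc (β ^ 2) (2 ^ p), mul_one_div,
      ← mul_rpow (by positivity) (by positivity),
      ← div_rpow (by positivity) hxs.le, rpow_neg (by positivity), ← inv_rpow (by positivity),
      ← mul_rpow (by positivity) (by positivity)]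
    congr 2
    have e : 1 - (s - 1) / (s + 1) * ((t - 1) / (t + 1)) = 2 * (s + t) / ((s + 1) * (t + 1)) := by
      field_simp
      ring
    rw [e]
    field_simp
  rw [hval] at h
  simpa only [hterm] using h

lemma summable_cayleyFun_mul (hp : 0 < p) (s t : ℝ) :
    Summable fun k => cayleyFun β p k s * cayleyFun β p k t := by
  rcases le_or_gt s 0 with hs | hs
  · simp [cayleyFun_of_nonpos hs]
  rcases le_or_gt t 0 with ht | ht
  · simp [cayleyFun_of_nonpos ht]
  exact (hasSum_cayleyFun_mul hp hs ht).summable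

end BinomialKernel

/-! ### Random power series coefficients. -/

section RegularVersion

open Filter Topology
open scoped ENNReal

variable {Ω H : Type*} [MeasurableSpace Ω] [NormedAddCommGroup H] [InnerProductSpace ℝ H]
  {W : H → Ω → ℝ} {P : Measure Ω}

/-- The coordinates of an isonormal process have measurable versions which are everywhere
admissible coefficients of a power series. -/
lemma IsIsonormal.exists_summable_version (hW : IsIsonormal W P) {e : ℕ → H} (he : Orthonormal ℝ e)
    {a : ℕ → ℝ} (ha0 : ∀ k, 0 ≤ a k)
    (ha : ∀ ρ : ℝ, 0 ≤ ρ → ρ < 1 → Summable fun k => a k * ρ ^ k) :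
    ∃ ζ : ℕ → Ω → ℝ, (∀ k, Measurable (ζ k)) ∧ (∀ k, ζ k =ᵐ[P] W (e k)) ∧
      ∀ ω (ρ : ℝ), 0 ≤ ρ → ρ < 1 → Summable fun k => |a k * ζ k ω| * ρ ^ k := by
  classical
  set ξ : ℕ → Ω → ℝ := fun k => (hW.aemeasurable (e k)).mk (W (e k)) with hξ
  have hξm : ∀ k, Measurable (ξ k) := fun k => (hW.aemeasurable (e k)).measurable_mk
  have hξe : ∀ k, ξ k =ᵐ[P] W (e k) := fun k => (hW.aemeasurable (e k)).ae_eq_mk.symm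
  -- Countably many radii increasing to 1 suffice, so one null set serves all radii.
  set ρ : ℕ → ℝ := fun m => m / (m + 1) with hρ
  have hρ0 : ∀ m, 0 ≤ ρ m := fun m => by positivity
  have hρ1 : ∀ m, ρ m < 1 := fun m => by
    simp only [hρ]
    rw [div_lt_one (by positivity)]
    linarith
  set S : ℕ → Ω → ℝ≥0∞ := fun m ω => ∑' k, ENNReal.ofReal (a k * ρ m ^ k) * ‖ξ k ω‖ₑ with hS
  have hSm : ∀ m, Measurable (S m) := fun m =>
    Measurable.tsum fun k => (hξm k).enorm.const_mul _
  set G : Set Ω := ⋂ m, {ω | S m ω < ⊤} with hG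
  have hGm : MeasurableSet G :=
    MeasurableSet.iInter fun m => measurableSet_lt (hSm m) measurable_const
  have hGae : ∀ᵐ ω ∂P, ω ∈ G := by
    simp only [hG, mem_iInter, mem_ofPred_eq]
    refine ae_all_iff.2 fun m => ae_lt_top (hSm m) ?_
    rw [lintegral_tsum fun k => ((hξm k).enorm.const_mul _).aemeasurable]
    have hle : ∀ k, ∫⁻ ω, ENNReal.ofReal (a k * ρ m ^ k) * ‖ξ k ω‖ₑ ∂P ≤
        ENNReal.ofReal (a k * ρ m ^ k) := fun k => by
      rw [lintegral_const_mul _ (hξm k).enorm]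
      refine mul_le_of_le_one_right' ?_
      have h1 : ∫⁻ ω, ‖ξ k ω‖ₑ ∂P = ∫⁻ ω, ‖W (e k) ω‖ₑ ∂P := by
        refine lintegral_congr_ae ?_
        filter_upwards [hξe k] with ω h
        rw [h]
      rw [h1]
      refine (hW.lintegral_enorm_le _).trans (le_of_eq ?_)
      rw [← ofReal_norm, he.1 k, ENNReal.ofReal_one]
    refine ne_top_of_le_ne_top ?_ (ENNReal.tsum_le_tsum hle)
    rw [← ENNReal.ofReal_tsum_of_nonneg (fun k => mul_nonneg (ha0 k) (pow_nonneg (hρ0 m) k))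
      (ha _ (hρ0 m) (hρ1 m))]
    exact ENNReal.ofReal_ne_top
  -- Setting all coefficients to zero off G makes the summability hold for every ω.
  refine ⟨fun k => G.indicator (ξ k), fun k => (hξm k).indicator hGm, fun k => ?_, ?_⟩
  · filter_upwards [hGae, hξe k] with ω h1 h2
    rw [indicator_of_mem h1, h2]
  · intro ω r hr0 hr1
    by_cases hω : ω ∈ G
    · obtain ⟨m, hm⟩ := exists_nat_ge (1 / (1 - r))
      have h1r : 0 < 1 - r := by linarith
      have hrm : r ≤ ρ m := by
        simp only [hρ]
        rw [le_div_iff₀ (by positivity)]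
        rw [div_le_iff₀ h1r] at hm
        linarith
      have hfin : S m ω < ⊤ := by
        have := mem_iInter.1 hω m
        exact this
      have e1 : S m ω = ∑' k, ENNReal.ofReal (|a k * ξ k ω| * ρ m ^ k) := by
        refine tsum_congr fun k => ?_
        rw [Real.enorm_eq_ofReal_abs, ← ENNReal.ofReal_mul
          (mul_nonneg (ha0 k) (pow_nonneg (hρ0 m) k)), abs_mul, abs_of_nonneg (ha0 k)]
        congr 1
        ring
      rw [e1] at hfin
      have hs : Summable fun k => |a k * ξ k ω| * ρ m ^ k := by
        have := ENNReal.summable_toReal hfin.ne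
        refine this.congr fun k => ?_
        rw [ENNReal.toReal_ofReal (mul_nonneg (abs_nonneg _) (pow_nonneg (hρ0 m) k))]
      refine Summable.of_nonneg_of_le (fun k => by positivity) (fun k => ?_) hs
      simp only [indicator_of_mem hω]
      gcongr
    · simp [indicator_of_notMem hω]

end RegularVersion

/-! ### The smooth Gaussian process as primitive of a random series. -/

section CayleyProcess

open Real Filter Topology
open scoped ENNReal

variable {Ω H : Type*} [MeasurableSpace Ω] [NormedAddCommGroup H] [InnerProductSpace ℝ H]
  {W : H → Ω → ℝ} {P : Measure Ω} {β p : ℝ} {e : ℕ → H}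

/-- The partial sums of `cayleyCurve`. -/
noncomputable def cayleyPartial (β p : ℝ) (e : ℕ → H) (n : ℕ) (s : ℝ) : H :=
  ∑ k ∈ Finset.range n, cayleyFun β p k s • e k

/-- A curve in a Hilbert space with `⟪b s, b t⟫ = β ^ 2 * 2 ^ p * (s + t) ^ (-p)`. -/
noncomputable def cayleyCurve (β p : ℝ) (e : ℕ → H) (s : ℝ) : H :=
  ∑' k, cayleyFun β p k s • e k

lemma inner_cayleyPartial (he : Orthonormal ℝ e) (n : ℕ) (s t : ℝ) :
    inner ℝ (cayleyPartial β p e n s) (cayleyPartial β p e n t) =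
      ∑ k ∈ Finset.range n, cayleyFun β p k s * cayleyFun β p k t := by
  rw [cayleyPartial, cayleyPartial, he.inner_sum]
  simp

lemma stronglyMeasurable_cayleyPartial (n : ℕ) :
    StronglyMeasurable (cayleyPartial β p e n) := by
  unfold cayleyPartial
  exact Finset.stronglyMeasurable_fun_sum _ fun k _ =>
    (measurable_cayleyFun k).stronglyMeasurable.smul_const _

lemma tendsto_cayleyPartial [CompleteSpace H] (hp : 0 < p) (he : Orthonormal ℝ e) (s : ℝ) :
    Tendsto (fun n => cayleyPartial β p e n s) atTop (𝓝 (cayleyCurve β p e s)) := by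
  refine HasSum.tendsto_sum_nat (Summable.hasSum ?_)
  have h := (he.orthogonalFamily.summable_iff_norm_sq_summable
    (fun k => cayleyFun β p k s)).2 (by
      simpa [sq] using summable_cayleyFun_mul (β := β) hp s s)
  simpa using h

lemma stronglyMeasurable_cayleyCurve [CompleteSpace H] (hp : 0 < p) (he : Orthonormal ℝ e) :
    StronglyMeasurable (cayleyCurve β p e) :=
  stronglyMeasurable_of_tendsto atTop (fun n => stronglyMeasurable_cayleyPartial n)
    (tendsto_pi_nhds.2 fun s => tendsto_cayleyPartial hp he s)

lemma inner_cayleyCurve [CompleteSpace H] (hp : 0 < p) (he : Orthonormal ℝ e) (s t : ℝ) :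
    inner ℝ (cayleyCurve β p e s) (cayleyCurve β p e t) =
      ∑' k, cayleyFun β p k s * cayleyFun β p k t := by
  have h1 := (tendsto_cayleyPartial (β := β) hp he s).inner (𝕜 := ℝ)
    (tendsto_cayleyPartial (β := β) hp he t)
  simp_rw [inner_cayleyPartial he] at h1
  exact tendsto_nhds_unique h1 (summable_cayleyFun_mul hp s t).hasSum.tendsto_sum_nat

lemma inner_cayleyCurve_of_pos [CompleteSpace H] (hp : 0 < p) (he : Orthonormal ℝ e) {s t : ℝ}
    (hs : 0 < s) (ht : 0 < t) :
    inner ℝ (cayleyCurve β p e s) (cayleyCurve β p e t) = β ^ 2 * 2 ^ p * (s + t) ^ (-p) := by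
  rw [inner_cayleyCurve hp he, (hasSum_cayleyFun_mul hp hs ht).tsum_eq]

lemma norm_cayleyPartial_le [CompleteSpace H] (hp : 0 < p) (he : Orthonormal ℝ e) (n : ℕ) (s : ℝ) :
    ‖cayleyPartial β p e n s‖ ≤ ‖cayleyCurve β p e s‖ := by
  refine le_of_sq_le_sq ?_ (norm_nonneg _)
  rw [← real_inner_self_eq_norm_sq, ← real_inner_self_eq_norm_sq, inner_cayleyPartial he,
    inner_cayleyCurve hp he]
  exact (summable_cayleyFun_mul hp s s).sum_le_tsum _ fun k _ => mul_self_nonneg _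

lemma norm_cayleyCurve [CompleteSpace H] (hp : 0 < p) (he : Orthonormal ℝ e) {s : ℝ}
    (hs : 0 < s) : ‖cayleyCurve β p e s‖ = |β| * s ^ (-p / 2) := by
  rw [← sq_eq_sq₀ (norm_nonneg _) (by positivity), ← real_inner_self_eq_norm_sq,
    inner_cayleyCurve_of_pos hp he hs hs, mul_pow, sq_abs, ← two_mul,
    mul_rpow (by norm_num) hs.le, rpow_neg (by norm_num), ← rpow_natCast (s ^ (-p / 2)),
    ← rpow_mul hs.le]
  have : (2 : ℝ) ^ p ≠ 0 := by positivity
  push_cast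
  rw [div_mul_cancel₀ _ (by norm_num)]
  field_simp

/-- The norm is |β| s^(-p/2), integrable at 0 since p < 2. -/
lemma integrableOn_cayleyCurve [CompleteSpace H] (hp : 0 < p) (hp2 : p < 2)
    (he : Orthonormal ℝ e) {t : ℝ} (ht : 0 ≤ t) :
    IntegrableOn (cayleyCurve β p e) (Ioc 0 t) := by
  have h1 : IntegrableOn (fun s : ℝ => |β| * s ^ (-p / 2)) (Ioc 0 t) :=
    ((intervalIntegrable_iff_integrableOn_Ioc_of_le ht).1
      (intervalIntegral.intervalIntegrable_rpow' (by linarith))).const_mul _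
  refine h1.mono' (stronglyMeasurable_cayleyCurve hp he).aestronglyMeasurable ?_
  refine (ae_restrict_iff' measurableSet_Ioc).2 (Eventually.of_forall fun s hs => ?_)
  rw [norm_cayleyCurve hp he hs.1]

lemma integrableOn_cayleyPartial [CompleteSpace H] (hp : 0 < p) (hp2 : p < 2)
    (he : Orthonormal ℝ e) {t : ℝ} (ht : 0 ≤ t) (n : ℕ) :
    IntegrableOn (cayleyPartial β p e n) (Ioc 0 t) :=
  Integrable.mono (integrableOn_cayleyCurve (β := β) hp hp2 he ht)
    (stronglyMeasurable_cayleyPartial n).aestronglyMeasurable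
    (Eventually.of_forall fun s => norm_cayleyPartial_le hp he n s)

/-- On the diagonal all terms b_k(s)² are nonnegative, so each is at most their sum β² s^(-p). -/
lemma integrableOn_cayleyFun (hp : 0 < p) (hp2 : p < 2) {t : ℝ} (ht : 0 ≤ t) (k : ℕ) :
    IntegrableOn (cayleyFun β p k) (Ioc 0 t) := by
  have h1 : IntegrableOn (fun s : ℝ => |β| * s ^ (-p / 2)) (Ioc 0 t) :=
    ((intervalIntegrable_iff_integrableOn_Ioc_of_le ht).1
      (intervalIntegral.intervalIntegrable_rpow' (by linarith))).const_mul _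
  refine h1.mono' (measurable_cayleyFun k).aestronglyMeasurable ?_
  refine (ae_restrict_iff' measurableSet_Ioc).2 (Eventually.of_forall fun s hs => ?_)
  have hs0 : 0 < s := hs.1
  have h2 := le_hasSum (hasSum_cayleyFun_mul (β := β) hp hs0 hs0) k fun j _ => mul_self_nonneg _
  refine le_of_sq_le_sq ?_ (by positivity)
  rw [Real.norm_eq_abs, sq_abs, sq]
  refine h2.trans (le_of_eq ?_)
  rw [mul_pow, sq_abs, ← two_mul,
    mul_rpow (by norm_num) hs0.le, rpow_neg (by norm_num), ← rpow_natCast (s ^ (-p / 2)),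
    ← rpow_mul hs0.le]
  have : (2 : ℝ) ^ p ≠ 0 := by positivity
  push_cast
  rw [div_mul_cancel₀ _ (by norm_num)]
  field_simp

/-- The integral of `cayleyCurve`, with `⟪r s, r t⟫` a multiple of `s ^ K + t ^ K - (s + t) ^ K`. -/
noncomputable def cayleyPrimitive (β p : ℝ) (e : ℕ → H) (t : ℝ) : H :=
  ∫ s in Ioc 0 t, cayleyCurve β p e s

/-- Orthogonality passes to limits and Bochner integrals; this is the source of the independence of
R and v(x). -/
lemma inner_cayleyPrimitive_eq_zero [CompleteSpace H] (hp : 0 < p) (hp2 : p < 2)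
    (he : Orthonormal ℝ e) {f : H} (hf : ∀ k, inner ℝ (e k) f = 0) {t : ℝ} (ht : 0 ≤ t) :
    inner ℝ (cayleyPrimitive β p e t) f = 0 := by
  have h : ∀ s, inner ℝ f (cayleyCurve β p e s) = 0 := fun s => by
    have h1 := (tendsto_cayleyPartial (β := β) hp he s).inner (𝕜 := ℝ)
      (tendsto_const_nhds (x := f))
    have h2 : ∀ n, inner ℝ (cayleyPartial β p e n s) f = 0 := fun n => by
      simp [cayleyPartial, sum_inner, inner_smul_left, hf]
    simp_rw [h2] at h1
    rw [real_inner_comm]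
    exact (tendsto_nhds_unique h1 tendsto_const_nhds)
  rw [real_inner_comm, cayleyPrimitive, ← integral_inner (integrableOn_cayleyCurve hp hp2 he ht)]
  simp [h]

lemma inner_cayleyPrimitive [CompleteSpace H] (hp : 1 < p) (hp2 : p < 2)
    (he : Orthonormal ℝ e) {s t : ℝ} (hs : 0 ≤ s) (ht : 0 ≤ t) :
    inner ℝ (cayleyPrimitive β p e s) (cayleyPrimitive β p e t) =
      β ^ 2 * 2 ^ p / ((p - 1) * (2 - p)) *
        (s ^ (2 - p) + t ^ (2 - p) - (s + t) ^ (2 - p)) := by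
  have hp0 : 0 < p := by linarith
  have hp1 : p - 1 ≠ 0 := by linarith
  have hp1' : 1 - p ≠ 0 := by linarith
  have hp2' : 2 - p ≠ 0 := by linarith
  -- The pairing is the double integral of (x+y)^(-p). The inner integration stays away from the
  -- singularity as x > 0, and it leaves x^(1-p), integrable at 0 because p < 2.
  have inner1 : ∀ x : ℝ, 0 < x →
      inner ℝ (cayleyCurve β p e x) (cayleyPrimitive β p e t) =
        β ^ 2 * 2 ^ p / (p - 1) * (x ^ (1 - p) - (x + t) ^ (1 - p)) := fun x hx => by
    rw [cayleyPrimitive, ← integral_inner (integrableOn_cayleyCurve hp0 hp2 he ht)]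
    have : ∫ y in Ioc 0 t, inner ℝ (cayleyCurve β p e x) (cayleyCurve β p e y) =
        ∫ y in Ioc 0 t, β ^ 2 * 2 ^ p * (x + y) ^ (-p) :=
      setIntegral_congr_fun measurableSet_Ioc fun y hy =>
        inner_cayleyCurve_of_pos hp0 he hx hy.1
    rw [this, ← intervalIntegral.integral_of_le ht, intervalIntegral.integral_const_mul,
      intervalIntegral.integral_comp_add_left (fun y => y ^ (-p)), integral_rpow]
    · rw [add_zero, neg_add_eq_sub]
      field_simp
      ring
    · right
      refine ⟨by linarith, ?_⟩
      rw [uIcc_of_le (by linarith)]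
      intro h0
      have := h0.1
      linarith
  have hint1 : IntervalIntegrable (fun x : ℝ => x ^ (1 - p)) volume 0 s :=
    intervalIntegral.intervalIntegrable_rpow' (by linarith)
  have hint2 : IntervalIntegrable (fun x : ℝ => (x + t) ^ (1 - p)) volume 0 s := by
    have := (intervalIntegral.intervalIntegrable_rpow' (r := 1 - p) (by linarith) (a := t)
      (b := s + t)).comp_add_right t
    simpa using this
  have hdef : cayleyPrimitive β p e s = ∫ x in Ioc 0 s, cayleyCurve β p e x := rfl
  rw [real_inner_comm, hdef,
    ← integral_inner (integrableOn_cayleyCurve hp0 hp2 he hs)]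
  have : ∫ x in Ioc 0 s, inner ℝ (cayleyPrimitive β p e t) (cayleyCurve β p e x) =
      ∫ x in Ioc 0 s, β ^ 2 * 2 ^ p / (p - 1) * (x ^ (1 - p) - (x + t) ^ (1 - p)) :=
    setIntegral_congr_fun measurableSet_Ioc fun x hx => by
      rw [real_inner_comm, inner1 x hx.1]
  rw [this, ← intervalIntegral.integral_of_le hs, intervalIntegral.integral_const_mul,
    intervalIntegral.integral_sub hint1 hint2,
    intervalIntegral.integral_comp_add_right (fun x => x ^ (1 - p)),
    integral_rpow (Or.inl (by linarith)), integral_rpow (Or.inl (by linarith))]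
  have e1 : 1 - p + 1 = 2 - p := by ring
  rw [e1, zero_rpow hp2', zero_add]
  field_simp
  ring

/-- The random function `D` whose primitive is the smooth process. -/
noncomputable def cayleySeries (β p : ℝ) (ζ : ℕ → Ω → ℝ) (ω : Ω) (s : ℝ) : ℝ :=
  ∑' k, cayleyFun β p k s * ζ k ω

/-- The partial sums of `cayleySeries`. -/
noncomputable def cayleySeriesPartial (β p : ℝ) (ζ : ℕ → Ω → ℝ) (n : ℕ) (ω : Ω) (s : ℝ) : ℝ :=
  ∑ k ∈ Finset.range n, cayleyFun β p k s * ζ k ω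

variable {ζ : ℕ → Ω → ℝ}

omit [MeasurableSpace Ω] in
lemma cayleySeries_of_nonpos {s : ℝ} (hs : s ≤ 0) (ω : Ω) : cayleySeries β p ζ ω s = 0 := by
  simp [cayleySeries, cayleyFun_of_nonpos hs]

omit [MeasurableSpace Ω] in
lemma tendsto_cayleySeriesPartial
    (hζ : ∀ ω (ρ : ℝ), 0 ≤ ρ → ρ < 1 →
      Summable fun k => |√(negBinomialCoeff p k) * ζ k ω| * ρ ^ k) (ω : Ω) (s : ℝ) :
    Tendsto (fun n => cayleySeriesPartial β p ζ n ω s) atTop (𝓝 (cayleySeries β p ζ ω s)) := by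
  refine HasSum.tendsto_sum_nat (Summable.hasSum ?_)
  rcases le_or_gt s 0 with hs | hs
  · simp [cayleyFun_of_nonpos hs]
  · have h := ((hζ ω _ (abs_nonneg _) (abs_cayley_lt_one hs)).mul_left
      |β * (2 / (s + 1)) ^ p|)
    refine Summable.of_norm (h.congr fun k => ?_)
    rw [cayleyFun_of_pos hs, ← abs_pow, ← abs_mul, ← abs_mul, Real.norm_eq_abs]
    congr 1
    ring

-- Each path is a smooth prefactor times a power series in (s-1)/(s+1), which stays inside the unit
-- disc of convergence.
omit [MeasurableSpace Ω] in
lemma contDiffOn_cayleySeries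
    (hζ : ∀ ω (ρ : ℝ), 0 ≤ ρ → ρ < 1 →
      Summable fun k => |√(negBinomialCoeff p k) * ζ k ω| * ρ ^ k) (ω : Ω) {n : WithTop ℕ∞} :
    ContDiffOn ℝ n (cayleySeries β p ζ ω) (Ioi 0) := by
  have h := contDiffOn_tsum_mul_pow (hζ ω) (n := n)
  have h1 : ContDiffOn ℝ n (fun s : ℝ => (s - 1) / (s + 1)) (Ioi 0) := by
    refine ContDiffOn.div (by fun_prop) (by fun_prop) fun s hs => ?_
    have := mem_Ioi.1 hs
    positivity
  have h2 : ContDiffOn ℝ n (fun s : ℝ => β * (2 / (s + 1)) ^ p) (Ioi 0) := by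
    refine contDiffOn_const.mul (ContDiffOn.rpow_const_of_ne ?_ fun s hs => ?_)
    · refine ContDiffOn.div (by fun_prop) (by fun_prop) fun s hs => ?_
      have := mem_Ioi.1 hs
      positivity
    · have := mem_Ioi.1 hs
      positivity
  have h3 := h.comp h1 fun s hs => by
    rw [mem_ball_zero_iff]
    exact abs_cayley_lt_one hs
  refine (h2.mul h3).congr fun s hs => ?_
  simp only [Function.comp]
  rw [cayleySeries, ← tsum_mul_left]
  refine tsum_congr fun k => ?_
  rw [cayleyFun_of_pos hs]
  ring

lemma measurable_cayleySeriesPartial (hm : ∀ k, Measurable (ζ k)) (n : ℕ) :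
    Measurable (Function.uncurry (cayleySeriesPartial β p ζ n)) := by
  unfold cayleySeriesPartial Function.uncurry
  exact Finset.measurable_fun_sum _ fun k _ =>
    ((measurable_cayleyFun k).comp measurable_snd).mul ((hm k).comp measurable_fst)

lemma measurable_cayleySeries (hm : ∀ k, Measurable (ζ k))
    (hζ : ∀ ω (ρ : ℝ), 0 ≤ ρ → ρ < 1 →
      Summable fun k => |√(negBinomialCoeff p k) * ζ k ω| * ρ ^ k) :
    Measurable (Function.uncurry (cayleySeries β p ζ)) :=
  measurable_of_tendsto_metrizable (fun n => measurable_cayleySeriesPartial hm n)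
    (tendsto_pi_nhds.2 fun q => tendsto_cayleySeriesPartial hζ q.1 q.2)

/-- By Fatou, an almost sure limit agrees with an L¹ limit. -/
lemma ae_eq_of_tendsto_lintegral {X : ℕ → Ω → ℝ} {Z Y : Ω → ℝ} (hX : ∀ n, AEMeasurable (X n) P)
    (hY : AEMeasurable Y P) (hXZ : ∀ᵐ ω ∂P, Tendsto (fun n => X n ω) atTop (𝓝 (Z ω)))
    (h : Tendsto (fun n => ∫⁻ ω, ‖X n ω - Y ω‖ₑ ∂P) atTop (𝓝 0)) : Z =ᵐ[P] Y := by
  have hZ : AEMeasurable Z P := aemeasurable_of_tendsto_metrizable_ae atTop hX hXZ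
  have h1 : ∫⁻ ω, ‖Z ω - Y ω‖ₑ ∂P ≤ 0 := by
    calc ∫⁻ ω, ‖Z ω - Y ω‖ₑ ∂P = ∫⁻ ω, liminf (fun n => ‖X n ω - Y ω‖ₑ) atTop ∂P := by
          refine lintegral_congr_ae ?_
          filter_upwards [hXZ] with ω hω
          exact ((hω.sub_const (Y ω)).enorm.liminf_eq).symm
      _ ≤ liminf (fun n => ∫⁻ ω, ‖X n ω - Y ω‖ₑ ∂P) atTop :=
          lintegral_liminf_le' fun n => ((hX n).sub hY).enorm
      _ = 0 := h.liminf_eq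
  have h2 := (lintegral_eq_zero_iff' (hZ.sub hY).enorm).1 (le_antisymm h1 zero_le)
  filter_upwards [h2] with ω hω
  simpa [sub_eq_zero] using hω

lemma cayleySeriesPartial_ae_eq (hW : IsIsonormal W P) (hζe : ∀ k, ζ k =ᵐ[P] W (e k)) (n : ℕ)
    (s : ℝ) : (fun ω => cayleySeriesPartial β p ζ n ω s) =ᵐ[P] W (cayleyPartial β p e n s) := by
  have h1 : ∀ᵐ ω ∂P, ∀ k, ζ k ω = W (e k) ω := ae_all_iff.2 hζe
  filter_upwards [h1, hW.sum (Finset.range n) (fun k => cayleyFun β p k s) e] with ω h1 h2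
  rw [cayleyPartial, h2, cayleySeriesPartial]
  simp [h1]

lemma cayleySeries_ae_eq [CompleteSpace H] (hp : 0 < p) (he : Orthonormal ℝ e)
    (hW : IsIsonormal W P) (hm : ∀ k, Measurable (ζ k)) (hζe : ∀ k, ζ k =ᵐ[P] W (e k))
    (hζ : ∀ ω (ρ : ℝ), 0 ≤ ρ → ρ < 1 →
      Summable fun k => |√(negBinomialCoeff p k) * ζ k ω| * ρ ^ k) (s : ℝ) :
    (fun ω => cayleySeries β p ζ ω s) =ᵐ[P] W (cayleyCurve β p e s) := by
  refine ae_eq_of_tendsto_lintegral (X := fun n ω => cayleySeriesPartial β p ζ n ω s)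
    (fun n => ((measurable_cayleySeriesPartial hm n).comp measurable_prodMk_right).aemeasurable)
    (hW.aemeasurable _)
    (Eventually.of_forall fun ω => tendsto_cayleySeriesPartial hζ ω s) ?_
  have hlim : Tendsto (fun n => ‖cayleyPartial β p e n s - cayleyCurve β p e s‖ₑ) atTop (𝓝 0) := by
    have := ((tendsto_cayleyPartial (β := β) hp he s).sub_const (cayleyCurve β p e s)).enorm
    simpa using this
  refine tendsto_of_tendsto_of_tendsto_of_le_of_le tendsto_const_nhds hlim (fun _ => zero_le)
    fun n => ?_
  refine le_trans (le_of_eq ?_) (hW.lintegral_enorm_le _)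
  refine lintegral_congr_ae ?_
  filter_upwards [cayleySeriesPartial_ae_eq (β := β) (p := p) hW hζe n s,
    hW.sub (cayleyPartial β p e n s) (cayleyCurve β p e s)] with ω h1 h2
  rw [h1, h2]
  rfl

lemma lintegral_cayleySeries_sub_le [CompleteSpace H] (hp : 0 < p) (he : Orthonormal ℝ e)
    (hW : IsIsonormal W P) (hm : ∀ k, Measurable (ζ k)) (hζe : ∀ k, ζ k =ᵐ[P] W (e k))
    (hζ : ∀ ω (ρ : ℝ), 0 ≤ ρ → ρ < 1 →
      Summable fun k => |√(negBinomialCoeff p k) * ζ k ω| * ρ ^ k) (n : ℕ) (s : ℝ) :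
    ∫⁻ ω, ‖cayleySeries β p ζ ω s - cayleySeriesPartial β p ζ n ω s‖ₑ ∂P ≤
      ‖cayleyCurve β p e s - cayleyPartial β p e n s‖ₑ := by
  refine le_trans (le_of_eq ?_) (hW.lintegral_enorm_le _)
  refine lintegral_congr_ae ?_
  filter_upwards [cayleySeriesPartial_ae_eq (β := β) (p := p) hW hζe n s,
    cayleySeries_ae_eq (β := β) hp he hW hm hζe hζ s,
    hW.sub (cayleyCurve β p e s) (cayleyPartial β p e n s)] with ω h1 h2 h3
  rw [h1, h2, h3]
  rfl

/-- By Tonelli, the expectation of ∫|D| is at most the integral of ‖`cayleyCurve`‖, which is finite.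
-/
lemma ae_integrableOn_cayleySeries [CompleteSpace H] (hp : 0 < p) (hp2 : p < 2)
    (he : Orthonormal ℝ e)
    (hW : IsIsonormal W P) (hm : ∀ k, Measurable (ζ k)) (hζe : ∀ k, ζ k =ᵐ[P] W (e k))
    (hζ : ∀ ω (ρ : ℝ), 0 ≤ ρ → ρ < 1 →
      Summable fun k => |√(negBinomialCoeff p k) * ζ k ω| * ρ ^ k) :
    ∀ᵐ ω ∂P, ∀ t : ℝ, IntegrableOn (cayleySeries β p ζ ω) (Ioc 0 t) := by
  have := hW.gaussian.isProbabilityMeasure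
  have hmeas := measurable_cayleySeries (β := β) hm hζ
  have h : ∀ N : ℕ, ∀ᵐ ω ∂P, IntegrableOn (cayleySeries β p ζ ω) (Ioc 0 (N : ℝ)) := fun N => by
    have h1 : ∫⁻ ω, (∫⁻ s in Ioc 0 (N : ℝ), ‖cayleySeries β p ζ ω s‖ₑ) ∂P < ⊤ := by
      rw [lintegral_lintegral_swap (hmeas.enorm.aemeasurable)]
      have hle : ∀ s, ∫⁻ ω, ‖cayleySeries β p ζ ω s‖ₑ ∂P ≤ ‖cayleyCurve β p e s‖ₑ := fun s => by
        -- With n = 0 the partial sums are empty.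
        have := lintegral_cayleySeries_sub_le (β := β) hp he hW hm hζe hζ 0 s
        simpa [cayleySeriesPartial, cayleyPartial] using this
      exact (lintegral_mono hle).trans_lt
        (integrableOn_cayleyCurve hp hp2 he (Nat.cast_nonneg N)).2
    have h2 := ae_lt_top (Measurable.lintegral_prod_right' (ν := volume.restrict (Ioc 0 (N : ℝ)))
      hmeas.enorm) h1.ne
    filter_upwards [h2] with ω hω
    exact ⟨(hmeas.comp measurable_prodMk_left).aestronglyMeasurable, hω⟩
  filter_upwards [ae_all_iff.2 h] with ω hω t
  obtain ⟨N, hN⟩ := exists_nat_ge t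
  exact (hω N).mono_set (Ioc_subset_Ioc_right hN)

/-- A stochastic Fubini theorem: for partial sums it is finite linearity, and the truncation errors
on both sides are at most δ_n in L¹. -/
lemma integral_cayleySeries_ae_eq [CompleteSpace H] (hp : 0 < p) (hp2 : p < 2)
    (he : Orthonormal ℝ e)
    (hW : IsIsonormal W P) (hm : ∀ k, Measurable (ζ k)) (hζe : ∀ k, ζ k =ᵐ[P] W (e k))
    (hζ : ∀ ω (ρ : ℝ), 0 ≤ ρ → ρ < 1 →
      Summable fun k => |√(negBinomialCoeff p k) * ζ k ω| * ρ ^ k) {t : ℝ} (ht : 0 ≤ t) :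
    (fun ω => ∫ s in Ioc 0 t, cayleySeries β p ζ ω s) =ᵐ[P] W (cayleyPrimitive β p e t) := by
  have := hW.gaussian.isProbabilityMeasure
  have hmeas := measurable_cayleySeries (β := β) hm hζ
  have hmeasn := fun n => measurable_cayleySeriesPartial (β := β) (p := p) hm n
  set δ : ℕ → ℝ≥0∞ := fun n =>
    ∫⁻ s in Ioc 0 t, ‖cayleyCurve β p e s - cayleyPartial β p e n s‖ₑ with hδ
  have hδlim : Tendsto δ atTop (𝓝 0) := by
    have h := tendsto_lintegral_of_dominated_convergence' (μ := volume.restrict (Ioc 0 t))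
      (F := fun n s => ‖cayleyCurve β p e s - cayleyPartial β p e n s‖ₑ) (f := fun _ => 0)
      (fun s => 2 * ‖cayleyCurve β p e s‖ₑ)
      (fun n => ((stronglyMeasurable_cayleyCurve hp he).sub
        (stronglyMeasurable_cayleyPartial n)).enorm.aemeasurable)
      (fun n => Eventually.of_forall fun s => ?_) ?_
      (Eventually.of_forall fun s => ?_)
    · simpa [hδ] using h
    · refine (enorm_sub_le).trans ?_
      simp only [two_mul]
      gcongr
      rw [← ofReal_norm, ← ofReal_norm]
      exact ENNReal.ofReal_le_ofReal (norm_cayleyPartial_le hp he n s)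
    · rw [lintegral_const_mul' _ _ (by norm_num)]
      exact ENNReal.mul_ne_top (by norm_num) (integrableOn_cayleyCurve hp hp2 he ht).2.ne
    · have := ((tendsto_const_nhds (x := cayleyCurve β p e s)).sub
        (tendsto_cayleyPartial (β := β) hp he s)).enorm
      simpa using this
  have hRn : ∀ n, (fun ω => ∫ s in Ioc 0 t, cayleySeriesPartial β p ζ n ω s) =ᵐ[P]
      W (∫ s in Ioc 0 t, cayleyPartial β p e n s) := fun n => by
    have hI := fun k => integrableOn_cayleyFun (β := β) hp hp2 ht k
    have e1 : ∫ s in Ioc 0 t, cayleyPartial β p e n s =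
        ∑ k ∈ Finset.range n, (∫ s in Ioc 0 t, cayleyFun β p k s) • e k := by
      simp only [cayleyPartial]
      rw [integral_finsetSum _ fun k _ => (hI k).smul_const (e k)]
      exact Finset.sum_congr rfl fun k _ => integral_smul_const _ _
    rw [e1]
    have h1 : ∀ᵐ ω ∂P, ∀ k, ζ k ω = W (e k) ω := ae_all_iff.2 hζe
    filter_upwards [h1, hW.sum (Finset.range n) (fun k => ∫ s in Ioc 0 t, cayleyFun β p k s) e]
      with ω h1 h2
    rw [h2]
    simp only [cayleySeriesPartial]
    rw [integral_finsetSum _ fun k _ => (hI k).mul_const (ζ k ω)]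
    refine Finset.sum_congr rfl fun k _ => ?_
    rw [integral_mul_const, h1]
  -- The sequence is constant in n, so the bound δ_n + δ_n → 0 shows that the L¹ distance is zero.
  refine ae_eq_of_tendsto_lintegral (X := fun _ ω => ∫ s in Ioc 0 t, cayleySeries β p ζ ω s)
    (fun _ => (hmeas.stronglyMeasurable.integral_prod_right).measurable.aemeasurable)
    (hW.aemeasurable _) (Eventually.of_forall fun ω => tendsto_const_nhds) ?_
  have hδ2 : Tendsto (fun n => δ n + δ n) atTop (𝓝 0) := by simpa using hδlim.add hδlim
  refine tendsto_of_tendsto_of_tendsto_of_le_of_le tendsto_const_nhds hδ2 (fun _ => zero_le)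
    fun n => ?_
  have hF : Measurable fun ω => ∫⁻ s in Ioc 0 t,
      ‖cayleySeries β p ζ ω s - cayleySeriesPartial β p ζ n ω s‖ₑ :=
    Measurable.lintegral_prod_right' (hmeas.sub (hmeasn n)).enorm
  have hFle : ∫⁻ ω, (∫⁻ s in Ioc 0 t,
      ‖cayleySeries β p ζ ω s - cayleySeriesPartial β p ζ n ω s‖ₑ) ∂P ≤ δ n := by
    rw [lintegral_lintegral_swap ((hmeas.sub (hmeasn n)).enorm.aemeasurable)]
    exact lintegral_mono fun s => lintegral_cayleySeries_sub_le hp he hW hm hζe hζ n s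
  have hG : ‖(∫ s in Ioc 0 t, cayleyPartial β p e n s) - cayleyPrimitive β p e t‖ₑ ≤ δ n := by
    rw [cayleyPrimitive, ← integral_sub (integrableOn_cayleyPartial hp hp2 he ht n)
      (integrableOn_cayleyCurve hp hp2 he ht)]
    refine (enorm_integral_le_lintegral_enorm _).trans (le_of_eq ?_)
    refine lintegral_congr fun s => ?_
    rw [← ofReal_norm, norm_sub_rev, ofReal_norm]
  calc ∫⁻ ω, ‖(∫ s in Ioc 0 t, cayleySeries β p ζ ω s) - W (cayleyPrimitive β p e t) ω‖ₑ ∂P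
      ≤ ∫⁻ ω, ((∫⁻ s in Ioc 0 t, ‖cayleySeries β p ζ ω s - cayleySeriesPartial β p ζ n ω s‖ₑ) +
          ‖W ((∫ s in Ioc 0 t, cayleyPartial β p e n s) - cayleyPrimitive β p e t) ω‖ₑ) ∂P := by
        refine lintegral_mono_ae ?_
        filter_upwards [hRn n, hW.sub (∫ s in Ioc 0 t, cayleyPartial β p e n s)
          (cayleyPrimitive β p e t), ae_integrableOn_cayleySeries (β := β) hp hp2 he hW hm hζe hζ]
          with ω h1 h2 h3
        have hIn : IntegrableOn (cayleySeriesPartial β p ζ n ω) (Ioc 0 t) := by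
          unfold cayleySeriesPartial
          exact integrable_finsetSum _ fun k _ =>
            (integrableOn_cayleyFun (β := β) hp hp2 ht k).mul_const _
        rw [h2, Pi.sub_apply, ← h1]
        have h4 : (∫ s in Ioc 0 t, cayleySeries β p ζ ω s) - W (cayleyPrimitive β p e t) ω =
            (∫ s in Ioc 0 t, (cayleySeries β p ζ ω s - cayleySeriesPartial β p ζ n ω s)) +
              ((∫ s in Ioc 0 t, cayleySeriesPartial β p ζ n ω s) -
                W (cayleyPrimitive β p e t) ω) := by
          rw [integral_sub (h3 t) hIn]
          ring
        rw [h4]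
        refine (enorm_add_le _ _).trans ?_
        gcongr
        exact enorm_integral_le_lintegral_enorm _
    _ ≤ δ n + δ n := by
        rw [lintegral_add_left hF]
        gcongr
        exact (hW.lintegral_enorm_le _).trans hG

/-- Over an orthonormal sequence of an isonormal process there is a Gaussian process with
covariance `C * (s ^ K + t ^ K - (s + t) ^ K)` whose paths are absolutely continuous and smooth away
from the origin. -/
theorem IsIsonormal.exists_smooth_process [CompleteSpace H] (hW : IsIsonormal W P)
    (he : Orthonormal ℝ e) {K C : ℝ} (hK0 : 0 < K) (hK1 : K < 1) (hC : 0 ≤ C) :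
    ∃ (r : ℝ≥0 → H) (R : ℝ≥0 → Ω → ℝ),
      (∀ f : H, (∀ k, inner ℝ (e k) f = 0) → ∀ t, inner ℝ (r t) f = 0) ∧
      (∀ s t : ℝ≥0, inner ℝ (r s) (r t) =
        C * ((s : ℝ) ^ K + (t : ℝ) ^ K - ((s : ℝ) + t) ^ K)) ∧
      (∀ t, R t =ᵐ[P] W (r t)) ∧
      ∀ᵐ ω ∂P, (∀ T : ℝ, 0 ≤ T →
          AbsolutelyContinuousOnInterval (fun t : ℝ => R t.toNNReal ω) 0 T) ∧
        ContDiffOn ℝ ((⊤ : ℕ∞) : WithTop ℕ∞) (fun t : ℝ => R t.toNNReal ω) (Ioi 0) ∧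
        Continuous fun t => R t ω := by
  set p := 2 - K with hp
  -- Chosen so that β² 2^p / ((p-1)(2-p)) = C, where p - 1 = 1 - K and 2 - p = K.
  set β := √(C * ((1 - K) * K) / 2 ^ p) with hβ
  have hp1 : 1 < p := by linarith
  have hp2 : p < 2 := by linarith
  have hp0 : 0 < p := by linarith
  obtain ⟨ζ, hm, hζe, hζ⟩ := hW.exists_summable_version he
    (a := fun k => √(negBinomialCoeff p k)) (fun k => Real.sqrt_nonneg _)
    (fun ρ h0 h1 => summable_sqrt_negBinomialCoeff hp0 h0 h1)
  -- The series vanishes on (-∞, 0], so the primitive on the whole line agrees with R at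
  -- `t.toNNReal` even for negative t.
  have hR : ∀ (t : ℝ) ω, ∫ s in Ioc 0 (t.toNNReal : ℝ), cayleySeries β p ζ ω s =
      ∫ s in (0 : ℝ)..t, cayleySeries β p ζ ω s := fun t ω => by
    rcases le_total 0 t with ht | ht
    · rw [Real.coe_toNNReal _ ht, intervalIntegral.integral_of_le ht]
    · rw [Real.toNNReal_of_nonpos ht, intervalIntegral.integral_of_ge ht]
      simp only [NNReal.coe_zero, Ioc_self, Measure.restrict_empty, integral_zero_measure]
      rw [setIntegral_eq_zero_of_forall_eq_zero, neg_zero]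
      exact fun s hs => cayleySeries_of_nonpos hs.2 ω
  refine ⟨fun t => cayleyPrimitive β p e t,
    fun t ω => ∫ s in Ioc 0 (t : ℝ), cayleySeries β p ζ ω s, fun f hf t => ?_, fun s t => ?_,
    fun t => ?_, ?_⟩
  · exact inner_cayleyPrimitive_eq_zero hp0 hp2 he hf t.coe_nonneg
  · rw [inner_cayleyPrimitive hp1 hp2 he s.coe_nonneg t.coe_nonneg]
    have h1K : 0 < 1 - K := by linarith
    have e1 : p - 1 = 1 - K := by rw [hp]; ring
    have e2 : 2 - p = K := by rw [hp]; ring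
    rw [hβ, Real.sq_sqrt (by positivity), e1, e2]
    have : (2 : ℝ) ^ p ≠ 0 := by positivity
    field_simp
  · exact integral_cayleySeries_ae_eq hp0 hp2 he hW hm hζe hζ t.coe_nonneg
  · filter_upwards [ae_integrableOn_cayleySeries (β := β) hp0 hp2 he hW hm hζe hζ] with ω hω
    simp only [hR]
    have hI : Integrable ((Iic 0).indicator (cayleySeries β p ζ ω)) := by
      have : (Iic 0).indicator (cayleySeries β p ζ ω) = 0 := by
        ext s
        by_cases hs : s ≤ 0
        · simp [cayleySeries_of_nonpos hs]
        · simp [hs]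
      rw [this]
      exact integrable_zero _ _ _
    have hIic : IntegrableOn (cayleySeries β p ζ ω) (Iic 0) :=
      (integrable_indicator_iff measurableSet_Iic).1 hI
    have hint : ∀ a b, IntervalIntegrable (cayleySeries β p ζ ω) volume a b := fun a b => by
      have hU := hIic.union (hω (max a b))
      refine (intervalIntegrable_iff.2 (hU.mono_set fun s hs => ?_))
      rcases le_or_gt s 0 with h | h
      · exact Or.inl h
      · exact Or.inr ⟨h, hs.2⟩
    have hcd := contDiffOn_cayleySeries (β := β) hζ ω (n := ((⊤ : ℕ∞) : WithTop ℕ∞))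
    have hderiv : ∀ t ∈ Ioi (0 : ℝ), HasDerivAt
        (fun t => ∫ s in (0 : ℝ)..t, cayleySeries β p ζ ω s) (cayleySeries β p ζ ω t) t :=
      fun t ht => intervalIntegral.integral_hasDerivAt_right (hint 0 t)
        (hcd.continuousOn.stronglyMeasurableAtFilter isOpen_Ioi t ht)
        (hcd.continuousOn.continuousAt (isOpen_Ioi.mem_nhds ht))
    refine ⟨fun T _ => (hint 0 T).absolutelyContinuousOnInterval_intervalIntegral
      left_mem_uIcc, ?_, ?_⟩
    · rw [contDiffOn_infty_iff_deriv_of_isOpen isOpen_Ioi]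
      exact ⟨fun t ht => (hderiv t ht).differentiableAt.differentiableWithinAt,
        hcd.congr fun t ht => (hderiv t ht).deriv⟩
    · have h1 := (intervalIntegral.continuous_primitive hint 0).comp NNReal.continuous_coe
      refine h1.congr fun t => ?_
      simp only [Function.comp]
      rw [intervalIntegral.integral_of_le t.coe_nonneg]

end CayleyProcess

/-! ### Noise orthogonal to v(x): functions odd in space about x. -/

section OddFunctions

variable {α : ℝ}

/-- A compactly supported function with unit norm which is odd about `x`. -/
noncomputable def oddProfile (x y : ℝ) : ℝ :=
  (Icc (x - 1) (x + 1)).indicator (fun y => √(3 / 2) * (y - x)) y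

lemma oddProfile_reflect (x y : ℝ) : oddProfile x (2 * x - y) = -oddProfile x y := by
  have h : 2 * x - y ∈ Icc (x - 1) (x + 1) ↔ y ∈ Icc (x - 1) (x + 1) := by
    simp only [mem_Icc]
    constructor <;> rintro ⟨h1, h2⟩ <;> constructor <;> linarith
  by_cases hy : y ∈ Icc (x - 1) (x + 1)
  · rw [oddProfile, oddProfile, indicator_of_mem hy, indicator_of_mem (h.2 hy)]
    ring
  · rw [oddProfile, oddProfile, indicator_of_notMem hy, indicator_of_notMem (mt h.1 hy), neg_zero]

lemma oddProfile_mul_self (x y : ℝ) : oddProfile x y * oddProfile x y =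
    (Icc (x - 1) (x + 1)).indicator (fun y => 3 / 2 * (y - x) ^ 2) y := by
  by_cases hy : y ∈ Icc (x - 1) (x + 1)
  · rw [oddProfile, indicator_of_mem hy, indicator_of_mem hy]
    linear_combination (y - x) ^ 2 * Real.mul_self_sqrt (show (0 : ℝ) ≤ 3 / 2 by norm_num)
  · rw [oddProfile, indicator_of_notMem hy, indicator_of_notMem hy, zero_mul]

lemma measurable_oddProfile (x : ℝ) : Measurable (oddProfile x) :=
  Measurable.indicator (by fun_prop) measurableSet_Icc

lemma integrable_oddProfile_mul_self (x : ℝ) :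
    Integrable fun y => oddProfile x y * oddProfile x y := by
  simp_rw [oddProfile_mul_self]
  rw [integrable_indicator_iff measurableSet_Icc]
  exact ContinuousOn.integrableOn_Icc (by fun_prop)

/-- The factor √(3/2) comes from ∫ y² dy = 2/3 over [-1, 1]. -/
lemma integral_oddProfile_mul_self (x : ℝ) : ∫ y, oddProfile x y * oddProfile x y = 1 := by
  simp_rw [oddProfile_mul_self]
  rw [integral_indicator measurableSet_Icc, integral_Icc_eq_integral_Ioc,
    ← intervalIntegral.integral_of_le (by linarith), intervalIntegral.integral_const_mul,
    intervalIntegral.integral_comp_sub_right (fun y => y ^ 2), integral_pow]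
  ring

/-- A sequence of orthonormal functions on `(0, ∞) × ℝ` which are odd about `x` in space. -/
noncomputable def oddFun (x : ℝ) (k : ℕ) (q : ℝ × ℝ) : ℝ :=
  (Ioo (k : ℝ) (k + 1)).indicator (fun _ => 1) q.1 * oddProfile x q.2

lemma measurable_oddFun (x : ℝ) (k : ℕ) : Measurable (oddFun x k) :=
  ((Measurable.indicator measurable_const measurableSet_Ioo).comp measurable_fst).mul
    ((measurable_oddProfile x).comp measurable_snd)

lemma oddFun_mul (x : ℝ) (j k : ℕ) (q : ℝ × ℝ) : oddFun x j q * oddFun x k q =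
    (Ioo (j : ℝ) (j + 1) ∩ Ioo (k : ℝ) (k + 1)).indicator (fun _ => 1) q.1 *
      (oddProfile x q.2 * oddProfile x q.2) := by
  have := inter_indicator_mul (s := Ioo (j : ℝ) (j + 1)) (t := Ioo (k : ℝ) (k + 1))
    (fun _ => (1 : ℝ)) (fun _ => 1) q.1
  simp only [mul_one] at this
  rw [oddFun, oddFun, this]
  ring

lemma memLp_oddFun (x : ℝ) (k : ℕ) : MemLp (oddFun x k) 2 spaceTimeMeasure := by
  rw [memLp_two_iff_integrable_sq (measurable_oddFun x k).aestronglyMeasurable]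
  simp_rw [sq, oddFun_mul, inter_self]
  refine Integrable.mul_prod (f := (Ioo (k : ℝ) (k + 1)).indicator fun _ => (1 : ℝ)) ?_
    (integrable_oddProfile_mul_self x)
  rw [integrable_indicator_iff measurableSet_Ioo]
  exact integrableOn_const (hs := by
    rw [Measure.restrict_apply measurableSet_Ioo]
    exact ((measure_mono inter_subset_left).trans_lt measure_Ioo_lt_top).ne)

/-- Distinct indices live on disjoint time intervals. -/
lemma integral_oddFun_mul (x : ℝ) (j k : ℕ) :
    ∫ q, oddFun x j q * oddFun x k q ∂spaceTimeMeasure = if j = k then 1 else 0 := by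
  simp_rw [oddFun_mul]
  rw [spaceTimeMeasure, integral_prod_mul
    ((Ioo (j : ℝ) (j + 1) ∩ Ioo (k : ℝ) (k + 1)).indicator fun _ => (1 : ℝ))
    (fun y => oddProfile x y * oddProfile x y), integral_oddProfile_mul_self, mul_one,
    integral_indicator (measurableSet_Ioo.inter measurableSet_Ioo),
    Measure.restrict_restrict (measurableSet_Ioo.inter measurableSet_Ioo)]
  have hpos : ∀ k : ℕ, Ioo (k : ℝ) (k + 1) ⊆ Ioi 0 := fun k y hy =>
    lt_of_le_of_lt (Nat.cast_nonneg k) hy.1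
  rw [inter_eq_left.2 (inter_subset_left.trans (hpos j))]
  split_ifs with h
  · subst h
    simp
  · have : Ioo (j : ℝ) (j + 1) ∩ Ioo (k : ℝ) (k + 1) = ∅ := by
      rw [Ioo_inter_Ioo, Ioo_eq_empty_iff, not_lt]
      rcases Nat.lt_or_gt_of_ne h with h | h
      · have : (j : ℝ) + 1 ≤ k := by exact_mod_cast h
        exact (min_le_left _ _).trans (this.trans (le_max_right _ _))
      · have : (k : ℝ) + 1 ≤ j := by exact_mod_cast h
        exact (min_le_right _ _).trans (this.trans (le_max_left _ _))
    simp [this]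

lemma stableKernel_neg (α t x : ℝ) : stableKernel α t (-x) = stableKernel α t x := by
  simp [stableKernel]

lemma mildIntegrand_reflect (α t x r y : ℝ) :
    mildIntegrand α t x (r, 2 * x - y) = mildIntegrand α t x (r, y) := by
  have : 2 * x - y - x = -(y - x) := by ring
  simp only [mildIntegrand, this, stableKernel_neg]

/-- At each time the reflection y ↦ 2x - y reverses the sign of the integrand. -/
lemma integral_oddFun_mul_mildIntegrand (hα : 1 < α) {t : ℝ} (ht : 0 ≤ t) (x : ℝ) (k : ℕ) :
    ∫ q, oddFun x k q * mildIntegrand α t x q ∂spaceTimeMeasure = 0 := by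
  have hi : Integrable (fun q => oddFun x k q * mildIntegrand α t x q) spaceTimeMeasure :=
    (memLp_oddFun x k).integrable_mul (memLp_mildIntegrand hα ht x)
  rw [spaceTimeMeasure] at hi ⊢
  rw [integral_prod _ hi]
  have h : ∀ r : ℝ, ∫ y, oddFun x k (r, y) * mildIntegrand α t x (r, y) = 0 := fun r => by
    have h1 := integral_sub_left_eq_self
      (fun y => oddFun x k (r, y) * mildIntegrand α t x (r, y)) volume (2 * x)
    have h2 : ∀ y, oddFun x k (r, 2 * x - y) * mildIntegrand α t x (r, 2 * x - y) =
        -(oddFun x k (r, y) * mildIntegrand α t x (r, y)) := fun y => by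
      rw [mildIntegrand_reflect, oddFun, oddFun, oddProfile_reflect]
      ring
    simp_rw [h2] at h1
    rw [integral_neg] at h1
    linarith
  simp [h]

/-- The functions `oddFun x k` as elements of `L²((0, ∞) × ℝ)`. -/
noncomputable def oddElement (x : ℝ) (k : ℕ) : Lp ℝ 2 spaceTimeMeasure :=
  (memLp_oddFun x k).toLp (oddFun x k)

lemma orthonormal_oddElement (x : ℝ) : Orthonormal ℝ (oddElement x) := by
  rw [orthonormal_iff_ite]
  intro j k
  rw [← integral_oddFun_mul x j k, L2.inner_def]
  refine integral_congr_ae ?_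
  filter_upwards [(memLp_oddFun x j).coeFn_toLp, (memLp_oddFun x k).coeFn_toLp] with q h1 h2
  rw [oddElement, oddElement, h1, h2]
  simp [mul_comm]

lemma inner_oddElement_mildElement (hα : 1 < α) (x : ℝ) (k : ℕ) (t : ℝ≥0) :
    inner ℝ (oddElement x k) (mildElement hα x t) = 0 := by
  rw [← integral_oddFun_mul_mildIntegrand hα t.coe_nonneg x k, L2.inner_def]
  refine integral_congr_ae ?_
  filter_upwards [(memLp_oddFun x k).coeFn_toLp,
    (memLp_mildIntegrand hα t.coe_nonneg x).coeFn_toLp] with q h1 h2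
  rw [oddElement, mildElement, h1, h2]
  simp [mul_comm]

end OddFunctions

/-! ### The continuous version, the two identifications of law, and the conclusion. -/

section Main

lemma covariance_congr_ae {Ω : Type*} [MeasurableSpace Ω] {P : Measure Ω} {X X' Y Y' : Ω → ℝ}
    (hX : X =ᵐ[P] X') (hY : Y =ᵐ[P] Y') : cov[X, Y; P] = cov[X', Y'; P] := by
  rw [covariance, covariance, integral_congr_ae hX, integral_congr_ae hY]
  refine integral_congr_ae ?_
  filter_upwards [hX, hY] with ω h1 h2
  rw [h1, h2]

variable {Ω : Type*} [MeasurableSpace Ω] {P : Measure Ω} {α : ℝ}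
  {W : Lp ℝ 2 spaceTimeMeasure → Ω → ℝ}

lemma IsSpaceTimeWhiteNoise.isIsonormal (hW : IsSpaceTimeWhiteNoise W P) : IsIsonormal W P :=
  ⟨hW.gaussian, hW.mean_zero, hW.covariance⟩

lemma exists_continuous_version_mild (hα : 1 < α) (hW : IsIsonormal W P) (x : ℝ) :
    ∃ Z : ℝ≥0 → Ω → ℝ, (∀ ω, Continuous fun t => Z t ω) ∧
      ∀ t, Z t =ᵐ[P] W (mildElement hα x t) := by
  set K := (α - 1) / α with hK
  have hα0 : 0 < α := by positivity
  have hK0 : 0 < K := div_pos (by linarith) hα0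
  set A := 2 * (cAlpha α ^ 2 * 2 ^ (-K)) with hA
  have hA0 : 0 ≤ A := by positivity
  set M := ∫⁻ z, ‖z‖ₑ ^ (6 / K) ∂(gaussianReal 0 1) with hM
  have hM0 : M < ⊤ := IsIsonormal.lintegral_enorm_rpow_gaussian_lt_top (by positivity)
  -- The increment variance is of order |t-s|^K, so the moment of order 6/K is of order |t-s|^3.
  refine exists_continuous_modification (fun t => hW.aemeasurable _) (q := 6 / K) (by positivity)
    (C := ENNReal.ofReal (A ^ (3 / K)) * M)
    (ENNReal.mul_ne_top ENNReal.ofReal_ne_top hM0.ne) fun s t => ?_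
  have h1 : ∫⁻ ω, ‖W (mildElement hα x t) ω - W (mildElement hα x s) ω‖ₑ ^ (6 / K) ∂P =
      ∫⁻ ω, ‖W (mildElement hα x t - mildElement hα x s) ω‖ₑ ^ (6 / K) ∂P := by
    refine lintegral_congr_ae ?_
    filter_upwards [hW.sub (mildElement hα x t) (mildElement hα x s)] with ω h
    rw [h]
    rfl
  rw [h1, hW.lintegral_enorm_rpow _ (by positivity), mul_right_comm,
    ← ENNReal.ofReal_mul (by positivity)]
  refine mul_le_mul_left (ENNReal.ofReal_le_ofReal ?_) _
  have h2 := norm_mildElement_sub_sq_le hα x s t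
  rw [← hK, ← hA] at h2
  set n := ‖mildElement hα x t - mildElement hα x s‖ with hn
  have hn0 : 0 ≤ n := norm_nonneg _
  calc n ^ (6 / K) = (n ^ 2) ^ (3 / K) := by
        rw [← Real.rpow_natCast, ← Real.rpow_mul hn0]
        congr 1
        push_cast
        ring
    _ ≤ (A * |(t : ℝ) - s| ^ K) ^ (3 / K) := by gcongr
    _ = A ^ (3 / K) * |(t : ℝ) - s| ^ 3 := by
        rw [Real.mul_rpow hA0 (by positivity), ← Real.rpow_mul (abs_nonneg _),
          mul_div_cancel₀ _ hK0.ne', ← Real.rpow_natCast]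
        norm_num

lemma cAlpha_pos (hα : 1 < α) : 0 < cAlpha α := by
  have hα0 : 0 < α := by positivity
  have h1 : 0 < α - 1 := by linarith
  have hΓ : 0 < Real.Gamma (1 / α) := Real.Gamma_pos_of_pos (by positivity)
  exact Real.sqrt_pos.2 (by positivity)

lemma mildElement_zero (hα : 1 < α) (x : ℝ) : mildElement hα x 0 = 0 := by
  have hα0 : 0 < α := by positivity
  have hK0 : (α - 1) / α ≠ 0 := (div_pos (by linarith) hα0).ne'
  rw [← inner_self_eq_zero (𝕜 := ℝ), inner_mildElement]
  simp [Real.zero_rpow hK0]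

lemma isBifractionalBM_mild (hα : 1 < α) (hW : IsIsonormal W P) (x : ℝ) {V : ℝ≥0 → Ω → ℝ}
    (hV : ∀ t, V t =ᵐ[P] W (mildElement hα x t)) (hc : ∀ᵐ ω ∂P, Continuous fun t => V t ω) :
    IsBifractionalBM (1 / 2) ((α - 1) / α) (fun t ω => (cAlpha α)⁻¹ * V t ω) P where
  param_fst := by norm_num
  param_snd := by
    have hα0 : 0 < α := by positivity
    refine ⟨div_pos (by linarith) hα0, ?_⟩
    rw [div_le_one hα0]
    linarith
  gaussian := by
    refine ((hW.gaussian.comp_right (mildElement hα x)).smul fun _ => (cAlpha α)⁻¹).congr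
      fun t => ?_
    filter_upwards [hV t] with ω h
    rw [h]
    rfl
  mean_zero t := by
    rw [integral_const_mul, integral_congr_ae (hV t), hW.mean_zero, mul_zero]
  start := by
    filter_upwards [hV 0, hW.zero] with ω h1 h2
    rw [h1, mildElement_zero, h2]
    simp
  covariance s t := by
    have hc0 := (cAlpha_pos hα).ne'
    rw [covariance_const_mul_left, covariance_const_mul_right,
      covariance_congr_ae (hV s) (hV t), hW.covariance, inner_mildElement]
    have e1 : (2 : ℝ) * (1 / 2) = 1 := by norm_num
    rw [e1, one_mul, Real.rpow_one, Real.rpow_one]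
    field_simp
  continuous_paths := by
    filter_upwards [hc] with ω h
    exact continuous_const.mul h

/-- Orthogonality makes the covariances of V and R add, and the terms (s+t)^K cancel. -/
lemma isFractionalBM_of_mild_sub (hα : 1 < α) (hW : IsIsonormal W P) (x : ℝ)
    {V R : ℝ≥0 → Ω → ℝ} {r : ℝ≥0 → Lp ℝ 2 spaceTimeMeasure}
    (hV : ∀ t, V t =ᵐ[P] W (mildElement hα x t)) (hVc : ∀ᵐ ω ∂P, Continuous fun t => V t ω)
    (hR : ∀ t, R t =ᵐ[P] W (r t)) (hRc : ∀ᵐ ω ∂P, Continuous fun t => R t ω)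
    (hr : ∀ s t : ℝ≥0, inner ℝ (r s) (r t) = cAlpha α ^ 2 * 2 ^ (-((α - 1) / α)) *
      ((s : ℝ) ^ ((α - 1) / α) + (t : ℝ) ^ ((α - 1) / α) - ((s : ℝ) + t) ^ ((α - 1) / α)))
    (hrf : ∀ s t, inner ℝ (r s) (mildElement hα x t) = 0) :
    IsFractionalBM ((α - 1) / (2 * α))
      (fun t ω => (cAlpha α * (2 : ℝ) ^ (1 / (2 * α)))⁻¹ * (V t ω - R t ω)) P := by
  have hα0 : 0 < α := by positivity
  set K := (α - 1) / α with hK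
  have hK0 : 0 < K := div_pos (by linarith) hα0
  set κ := cAlpha α * (2 : ℝ) ^ (1 / (2 * α)) with hκ
  have hc0 := cAlpha_pos hα
  have hκ0 : 0 < κ := by positivity
  set g : ℝ≥0 → Lp ℝ 2 spaceTimeMeasure := fun t => mildElement hα x t - r t with hg
  have hVR : ∀ t, (fun ω => V t ω - R t ω) =ᵐ[P] W (g t) := fun t => by
    filter_upwards [hV t, hR t, hW.sub (mildElement hα x t) (r t)] with ω h1 h2 h3
    rw [h1, h2, h3]
    rfl
  have hginner : ∀ s t : ℝ≥0, inner ℝ (g s) (g t) = cAlpha α ^ 2 * 2 ^ (-K) *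
      ((s : ℝ) ^ K + (t : ℝ) ^ K - |(s : ℝ) - t| ^ K) := fun s t => by
    simp only [hg]
    rw [inner_sub_left, inner_sub_right, inner_sub_right, hr, hrf,
      real_inner_comm (r t) (mildElement hα x s), hrf, inner_mildElement, ← hK]
    ring
  have hg0 : g 0 = 0 := by
    rw [← inner_self_eq_zero (𝕜 := ℝ), hginner]
    simp [Real.zero_rpow hK0.ne']
  clear_value g
  refine ⟨⟨by have : 0 < α - 1 := by linarith
              positivity, ?_⟩, ?_, fun t => ?_, ?_, fun s t => ?_, ?_⟩
  · rw [div_lt_one (by positivity)]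
    linarith
  · refine ((hW.gaussian.comp_right g).smul fun _ => κ⁻¹).congr fun t => ?_
    filter_upwards [hVR t] with ω h
    rw [h]
    rfl
  · rw [integral_const_mul, integral_congr_ae (hVR t), hW.mean_zero, mul_zero]
  · filter_upwards [hVR 0, hW.zero] with ω h1 h2
    rw [h1, hg0, h2]
    simp
  · have h1 : ∫ ω, |κ⁻¹ * (V t ω - R t ω) - κ⁻¹ * (V s ω - R s ω)| ^ 2 ∂P =
        ∫ ω, (κ ^ 2)⁻¹ * (W (g t - g s) ω * W (g t - g s) ω) ∂P := by
      refine integral_congr_ae ?_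
      filter_upwards [hVR t, hVR s, hW.sub (g t) (g s)] with ω h1 h2 h3
      rw [h1, h2, h3, sq_abs, Pi.sub_apply]
      ring
    have e1 : 2 * ((α - 1) / (2 * α)) = K := by
      rw [hK]
      field_simp
    -- Since 1/α = 1 - K, κ² is twice the covariance constant; the 2 comes from E|X_t - X_s|², where
    -- |t-s|^K appears twice.
    have e2 : κ ^ 2 = cAlpha α ^ 2 * (2 * 2 ^ (-K)) := by
      have e3 : (2 : ℝ) * 2 ^ (-K) = 2 ^ (1 + -K) := by
        rw [Real.rpow_add (by norm_num), Real.rpow_one]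
      rw [hκ, mul_pow, ← Real.rpow_natCast (2 ^ _), ← Real.rpow_mul (by norm_num), e3]
      congr 2
      rw [hK]
      push_cast
      field_simp
      ring
    rw [h1, integral_const_mul, hW.integral_mul, inner_sub_left, inner_sub_right,
      inner_sub_right, hginner, hginner, hginner, hginner, abs_sub_comm (s : ℝ) t, e1, e2]
    simp only [sub_self, abs_zero, Real.zero_rpow hK0.ne']
    have h2K : (2 : ℝ) ^ (-K) ≠ 0 := by positivity
    field_simp
    ring
  · filter_upwards [hVc, hRc] with ω h1 h2
    exact continuous_const.mul (h1.sub h2)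

end Main

theorem proposition2 {Ω : Type*} [MeasurableSpace Ω] (P : Measure Ω) [IsProbabilityMeasure P]
    (α : ℝ) (hα1 : 1 < α) (hα2 : α ≤ 2)
    (W : Lp ℝ 2 spaceTimeMeasure → Ω → ℝ) (hW : IsSpaceTimeWhiteNoise W P) :
    (∃ v : ℝ≥0 → ℝ → Ω → ℝ, IsMildSolution α W v P ∧
      ∀ (x : ℝ) (ω : Ω), Continuous fun t => v t x ω) ∧
    ∀ v : ℝ≥0 → ℝ → Ω → ℝ, IsMildSolution α W v P →
      ∀ x : ℝ, (∀ᵐ ω ∂P, Continuous fun t => v t x ω) →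
        IsBifractionalBM (1 / 2) ((α - 1) / α) (fun t ω => (cAlpha α)⁻¹ * v t x ω) P ∧
        ∃ X R : ℝ≥0 → Ω → ℝ,
          (∀ᵐ ω ∂P, ∀ t : ℝ≥0,
            v t x ω = cAlpha α * (2 : ℝ) ^ (1 / (2 * α)) * X t ω + R t ω) ∧
          IsFractionalBM ((α - 1) / (2 * α)) X P ∧
          IsGaussianProcess R P ∧
          (∀ t, ∫ ω, R t ω ∂P = 0) ∧
          IndepFun (fun ω t => R t ω) (fun ω t => v t x ω) P ∧
          (∀ᵐ ω ∂P, ∀ T : ℝ, 0 ≤ T →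
            AbsolutelyContinuousOnInterval (fun t : ℝ => R t.toNNReal ω) 0 T) ∧
          (∀ᵐ ω ∂P, ContDiffOn ℝ ((⊤ : ℕ∞) : WithTop ℕ∞) (fun t : ℝ => R t.toNNReal ω) (Ioi 0)) := by
  have hiso := hW.isIsonormal
  constructor
  · choose Z hZc hZ using exists_continuous_version_mild hα1 hiso
    refine ⟨fun t x => Z x t, fun t x => ?_, hZc⟩
    rw [wienerIntegral_mildIntegrand hα1]
    exact hZ x t
  · intro v hv x hvc
    have hV : ∀ t, v t x =ᵐ[P] W (mildElement hα1 x t) := fun t => by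
      rw [← wienerIntegral_mildIntegrand hα1 W]
      exact hv t x
    have hα0 : 0 < α := by positivity
    have hK0 : 0 < (α - 1) / α := div_pos (by linarith) hα0
    have hK1 : (α - 1) / α < 1 := by
      rw [div_lt_one hα0]
      linarith
    obtain ⟨r, R, hr0, hr, hR, hRp⟩ := hiso.exists_smooth_process (orthonormal_oddElement x)
      hK0 hK1 (show 0 ≤ cAlpha α ^ 2 * 2 ^ (-((α - 1) / α)) by positivity)
    have hrf : ∀ s t, inner ℝ (r s) (mildElement hα1 x t) = 0 := fun s t =>
      hr0 _ (fun k => inner_oddElement_mildElement hα1 x k t) s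
    have hκ0 : cAlpha α * (2 : ℝ) ^ (1 / (2 * α)) ≠ 0 := by
      have := cAlpha_pos hα1
      positivity
    -- X is defined by solving the decomposition for it, so the identity holds for every ω and t.
    refine ⟨isBifractionalBM_mild hα1 hiso x hV hvc,
      fun t ω => (cAlpha α * (2 : ℝ) ^ (1 / (2 * α)))⁻¹ * (v t x ω - R t ω), R,
      Filter.Eventually.of_forall fun ω t => ?_,
      isFractionalBM_of_mild_sub hα1 hiso x hV hvc hR (hRp.mono fun ω h => h.2.2) hr hrf,
      (hiso.gaussian.comp_right r).congr fun t => (hR t).symm,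
      fun t => by rw [integral_congr_ae (hR t), hiso.mean_zero], ?_,
      hRp.mono fun ω h => h.1, hRp.mono fun ω h => h.2.1⟩
    · rw [mul_inv_cancel_left₀ hκ0, sub_add_cancel]
    -- R and v(x) are jointly Gaussian as values of the same W, so vanishing cross-covariances give
    -- independence of the processes.
    · refine IsGaussianProcess.indepFun_of_covariance_eq_zero ?_
        (fun t => (hiso.aemeasurable _).congr (hR t).symm)
        (fun t => (hiso.aemeasurable _).congr (hV t).symm) fun s t => ?_
      · refine (hiso.gaussian.comp_right (Sum.elim r (mildElement hα1 x))).congr fun t => ?_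
        rcases t with t | t
        · exact (hR t).symm
        · exact (hV t).symm
      · rw [covariance_congr_ae (hR s) (hV t), hiso.covariance, hrf]
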